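/- **Setting.** A finite quantum set $\mathbb X$ is a finite-dimensional C*-algebra $C(\mathbb X)$ with its tracial 1-form $\psi$, i.e. the faithful positive tracial functional for which the multiplication $m$ satisfies $mm^*=\mathrm{id}$; here adjoints refer to the Hilbert space $\ell^2(\mathbb X)=C(\mathbb X)$ with $\langle x,y\rangle=\psi(x^*y)$. Let $\eta$ be the unit of $C(\mathbb X)$ and $I$ the identity operator. For operators $A,B$ on $\ell^2(\mathbb X)$ put $A\bullet B=m(A\otimes B)m^*$ and $\bar A f=(A(f^*))^*$. A quantum graph on $\mathbb X$ is a pair $(\mathbb X,A)$ with $A\bullet A=A=\bar A$; it is undirected if $A=A^*$, has no loops if $A\bullet I=0$, and is $d$-regular ($d\in\mathbb C$) if $A\eta=A^*\eta=d\eta$. It is regular if it is $d$-regular for some $d$. With respect to an orthonormal basis of $\ell^2(\mathbb X)$, $\mathcal O(\mathrm{Qut}(\mathbb X,A))$ is the universal $*$-algebra generated by the entries of a matrix $U=(u_{ij})$ subject to: $U$ is unitary, $m(U\otimes U)=Um$, $U\eta=\eta$, $UA=AU$; its comultiplication is $\Delta(u_{ij})=\sum_k u_{ik}\otimes u_{kj}$.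 For quantum graphs $(\mathbb X,A_i)$ on the same $\mathbb X$, $\mathcal O(\bigcap_i\mathrm{Qut}(\mathbb X,A_i))$ is the universal $*$-algebra generated by the entries of one matrix subject to the relations of all the $\mathrm{Qut}(\mathbb X,A_i)$ (for the empty family these are the first three relations), with the same formula for $\Delta$. **Theorem.** Let $\mathbb X$ be a finite quantum set, $n\in\mathbb N$ (possibly $0$), and let $(\mathbb X,A_i)$, $i=1,\dots,n$, be regular quantum graphs without loops. For a matrix $B$ indexed by $\{0,1,\dots,2n\}$ define the operator $$A'_B= I\otimes B+\sum_{i=1}^n\bigl(A_i\otimes E_{2i-1,2i}+A_i^*\otimes E_{2i,2i-1}\bigr)$$ on $\ell^2(\mathbb X)\otimes\mathbb C^{2n+1}=\ell^2(\mathbb X\otimes\mathbb C^{2n+1})$, where $E_{k,l}$ are the matrix units. (1) There is a symmetric matrix $B$ with entries in $\{0,1\}$ (the adjacency matrix of an undirected graph on $\{0,\dots,2n\}$, loops being allowed) such that $(\mathbb X\otimes\mathbb C^{2n+1},A'_B)$ is an undirected quantum graph and $$\mathrm{Qut}(\mathbb X\otimes\mathbb C^{2n+1},A'_B)=\bigcap_{i=1}^n\mathrm{Qut}(\mathbb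 X,A_i).$$ (2) Suppose that $n\ge 2$, that $A_i$ is $d_i$-regular with real $d_1\le\dots\le d_n$, and that $A_i\ne0$ whenever $2i\ge n$. Then $B$ in (1) can be taken to be the adjacency matrix of the following graph without loops: distinct $k,l>0$ are connected if and only if $k+l>2n$, and $0$ is connected exactly to the vertices $k>n$. In this case $(\mathbb X\otimes\mathbb C^{2n+1},A'_B)$ moreover has no loops. In both parts the equality of compact quantum groups means: there is an isomorphism of $*$-algebras $\mathcal O(\mathrm{Qut}(\mathbb X\otimes\mathbb C^{2n+1},A'_B))\cong\mathcal O(\bigcap_i\mathrm{Qut}(\mathbb X,A_i))$ that respects comultiplications and counits and maps the fundamental representation $U$ of the left side to $V^{\oplus(2n+1)}=V\otimes 1_{\mathbb C^{2n+1}}$, where $V$ is the fundamental representation of the right side. -/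

import Mathlib

open scoped TensorProduct ComplexOrder

noncomputable section

set_option linter.unusedSectionVars false
universe u v w

/-! ### Finite quantum sets and quantum graphs -/

/-- The adjoint `m* : C → C ⊗ C` of the multiplication with respect to the inner product
`⟨x, y⟩ = ψ (x* y)`, written in an orthonormal basis `b` of it:
`m* x = ∑ᵢⱼ ⟨bᵢ bⱼ, x⟩ bᵢ ⊗ bⱼ`. -/
def mulAdjoint {C : Type u} [CStarAlgebra C] {ι : Type v} [Fintype ι]
    (ψ : C →ₗ[ℂ] ℂ) (b : Module.Basis ι ℂ C) : C →ₗ[ℂ] C ⊗[ℂ] C :=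
  ∑ i, ∑ j, (ψ ∘ₗ LinearMap.mulLeft ℂ (star (b i * b j))).smulRight (b i ⊗ₜ[ℂ] b j)

/-- A finite quantum set `𝕏`, given by the finite-dimensional C*-algebra `C = C(𝕏)` with its
tracial 1-form `ψ` (a faithful positive tracial functional with `m m* = id`), together with a
chosen orthonormal basis of `ℓ²(𝕏)`, i.e. of `C` with the inner product `⟨x, y⟩ = ψ (x* y)`. -/
structure FiniteQuantumSet (C : Type u) [CStarAlgebra C]
    (ι : Type v) [Fintype ι] [DecidableEq ι] where
  psi : C →ₗ[ℂ] ℂ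
  psi_tracial : ∀ x y, psi (x * y) = psi (y * x)
  psi_nonneg : ∀ x, 0 ≤ psi (star x * x)
  psi_faithful : ∀ x, psi (star x * x) = 0 → x = 0
  basis : Module.Basis ι ℂ C
  orthonormal : ∀ i j, psi (star (basis i) * basis j) = if i = j then 1 else 0
  one_form : LinearMap.mul' ℂ C ∘ₗ mulAdjoint psi basis = LinearMap.id

namespace FiniteQuantumSet

variable {C : Type u} [CStarAlgebra C] {ι : Type v} [Fintype ι] [DecidableEq ι]

/-- The Schur product `A • B = m (A ⊗ B) m*`. -/
def schur (X : FiniteQuantumSet C ι) (A B : C →ₗ[ℂ] C) : C →ₗ[ℂ] C :=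
  LinearMap.mul' ℂ C ∘ₗ TensorProduct.map A B ∘ₗ mulAdjoint X.psi X.basis

/-- The adjoint of an operator on the Hilbert space `ℓ²(𝕏)`: the operator whose matrix in the
orthonormal basis is the conjugate transpose. -/
def adjoint (X : FiniteQuantumSet C ι) (A : C →ₗ[ℂ] C) : C →ₗ[ℂ] C :=
  Matrix.toLin X.basis X.basis (LinearMap.toMatrix X.basis X.basis A).conjTranspose

/-- `(𝕏, A)` is a (directed) quantum graph: `A` is a Schur idempotent and `A` equals its complex
conjugate `f ↦ (A (f*))*`. -/
structure IsQuantumGraph (X : FiniteQuantumSet C ι) (A : C →ₗ[ℂ] C) : Prop where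
  schur_self : X.schur A A = A
  real : ∀ f, star (A (star f)) = A f

/-- The quantum graph is undirected: `A = A*`. -/
def IsUndirected (X : FiniteQuantumSet C ι) (A : C →ₗ[ℂ] C) : Prop :=
  X.adjoint A = A

/-- The quantum graph has no loops: `A • I = 0`. -/
def NoLoops (X : FiniteQuantumSet C ι) (A : C →ₗ[ℂ] C) : Prop :=
  X.schur A LinearMap.id = 0

/-- The quantum graph is `d`-regular: `A η = A* η = d η`, where `η` is the unit of `C(𝕏)`. -/
def IsRegular (X : FiniteQuantumSet C ι) (A : C →ₗ[ℂ] C) (d : ℂ) : Prop :=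
  A 1 = d • (1 : C) ∧ X.adjoint A 1 = d • (1 : C)

/-! ### The quantum set `𝕏 ⊗ ℂᵐ` -/

theorem mul_mulAdjoint_apply (ψ : C →ₗ[ℂ] ℂ) (b : Module.Basis ι ℂ C) (x : C) :
    LinearMap.mul' ℂ C (mulAdjoint ψ b x) =
      ∑ i, ∑ j, ψ (star (b i * b j) * x) • (b i * b j) := by
  simp [mulAdjoint, LinearMap.sum_apply, mul_assoc]

/-- The functional `f ↦ ∑ₖ ψ (f k)` on `C(𝕏) ⊗ ℂᵐ`. -/
def prodPsi (X : FiniteQuantumSet C ι) (m : ℕ) : (Fin m → C) →ₗ[ℂ] ℂ :=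
  ∑ k : Fin m, X.psi ∘ₗ (LinearMap.proj k : (Fin m → C) →ₗ[ℂ] C)

theorem prodPsi_apply (X : FiniteQuantumSet C ι) (m : ℕ) (f : Fin m → C) :
    X.prodPsi m f = ∑ k, X.psi (f k) := by
  simp [prodPsi, LinearMap.sum_apply]

theorem prodPsi_single_mul (X : FiniteQuantumSet C ι) (m : ℕ) (k : Fin m) (x : C)
    (f : Fin m → C) : X.prodPsi m (star (Pi.single k x) * f) = X.psi (star x * f k) := by
  rw [prodPsi_apply, Finset.sum_eq_single k]
  · simp
  · intro l _ hl
    simp [Pi.single_eq_of_ne hl]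
  · simp

theorem prod_one_form (X : FiniteQuantumSet C ι) (m : ℕ) (f : Fin m → C) :
    LinearMap.mul' ℂ (Fin m → C)
      (mulAdjoint (X.prodPsi m) (Pi.basis fun _ : Fin m => X.basis) f) = f := by
  have hX : ∀ x : C, ∑ i, ∑ j, X.psi (star (X.basis i * X.basis j) * x) •
      (X.basis i * X.basis j) = x := fun x => by
    rw [← mul_mulAdjoint_apply]
    exact LinearMap.congr_fun X.one_form x
  have hmul : ∀ (k l : Fin m) (x y : C), (Pi.single k x : Fin m → C) * Pi.single l y =
      if k = l then Pi.single k (x * y) else 0 := by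
    intro k l x y
    split_ifs with h
    · subst h
      exact by simp only [Pi.single_mul]
    · ext p
      rw [Pi.mul_apply, Pi.zero_apply]
      by_cases hp : p = k
      · rw [Pi.single_eq_of_ne (i := l) (by rintro rfl; exact h hp.symm), mul_zero]
      · rw [Pi.single_eq_of_ne hp, zero_mul]
  rw [mul_mulAdjoint_apply]
  simp only [Fintype.sum_sigma, Pi.basis_apply, hmul]
  have hterm : ∀ (k : Fin m) (i : ι), (∑ l : Fin m, ∑ j : ι,
      X.prodPsi m (star (if k = l then Pi.single k (X.basis i * X.basis j) else 0) * f) •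
        (if k = l then (Pi.single k (X.basis i * X.basis j) : Fin m → C) else 0)) =
      Pi.single k (∑ j : ι, X.psi (star (X.basis i * X.basis j) * f k) •
        (X.basis i * X.basis j)) := by
    intro k i
    rw [Finset.sum_eq_single k]
    · simp only [if_true, prodPsi_single_mul]
      ext p
      by_cases hp : p = k
      · subst hp
        simp [Finset.sum_apply]
      · simp [Finset.sum_apply, Pi.single_eq_of_ne hp]
    · intro l _ hl
      simp [Ne.symm hl]
    · simp
  simp only [hterm]
  ext p
  rw [Finset.sum_apply, Finset.sum_eq_single p]
  · simp only [Finset.sum_apply, Pi.single_eq_same]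
    exact hX (f p)
  · intro k _ hk
    simp [Finset.sum_apply, Pi.single_eq_of_ne (Ne.symm hk)]
  · simp

/-- The finite quantum set `𝕏 ⊗ ℂᵐ`, where `ℂᵐ = C({0, …, m - 1})`: its algebra `C(𝕏) ⊗ ℂᵐ` is
the algebra `Fin m → C` of `m`-tuples (`x ⊗ e_k` is the tuple with `x` at place `k` and `0`
elsewhere), its 1-form is `f ↦ ∑ₖ ψ (f k)` and its orthonormal basis consists of the vectors
`bᵢ ⊗ e_k`, indexed by the pairs `⟨k, i⟩`. -/
def prod (X : FiniteQuantumSet C ι) (m : ℕ) :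
    FiniteQuantumSet (Fin m → C) (Σ _ : Fin m, ι) where
  psi := X.prodPsi m
  psi_tracial x y := by
    simp [prodPsi_apply, X.psi_tracial]
  psi_nonneg x := by
    rw [prodPsi_apply]
    exact Finset.sum_nonneg fun k _ => X.psi_nonneg (x k)
  psi_faithful x hx := by
    rw [prodPsi_apply] at hx
    have h := (Finset.sum_eq_zero_iff_of_nonneg fun k _ => X.psi_nonneg (x k)).1 hx
    ext k
    exact X.psi_faithful _ (h k (Finset.mem_univ k))
  basis := Pi.basis fun _ : Fin m => X.basis
  orthonormal := by
    rintro ⟨k, i⟩ ⟨l, j⟩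
    rw [Pi.basis_apply, Pi.basis_apply, prodPsi_single_mul]
    by_cases h : k = l
    · subst h
      simp [X.orthonormal]
    · simp [h]
  one_form := LinearMap.ext fun f => X.prod_one_form m f

/-- The operator `T ⊗ M` on `ℓ²(𝕏) ⊗ ℂᵐ`, i.e. `(T ⊗ M)(x ⊗ e_l) = ∑ₖ M_{kl} T x ⊗ e_k`. -/
def tensorMatrix {m : ℕ} (T : C →ₗ[ℂ] C) (M : Matrix (Fin m) (Fin m) ℂ) :
    (Fin m → C) →ₗ[ℂ] (Fin m → C) :=
  LinearMap.pi fun k => ∑ l, M k l • (T ∘ₗ (LinearMap.proj l : (Fin m → C) →ₗ[ℂ] C))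

end FiniteQuantumSet

/-! ### The universal `*`-algebra of a family of quantum graphs -/

/-- Names for the generators `u i j` and for their adjoints. -/
inductive QutGen (ι : Type v) : Type v
  | u (i j : ι) : QutGen ι
  | uStar (i j : ι) : QutGen ι

namespace QutGen

/-- The adjoint of a generator. -/
def bar {ι : Type v} : QutGen ι → QutGen ι
  | u i j => uStar i j
  | uStar i j => u i j

theorem bar_bar {ι : Type v} (g : QutGen ι) : g.bar.bar = g := by cases g <;> rfl

/-- The conjugate-linear antimultiplicative involution of the free algebra that exchanges every
generator with its adjoint, as a ring homomorphism to the opposite ring. -/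
def freeStar (ι : Type v) :
    FreeAlgebra ℂ (QutGen ι) →+* (FreeAlgebra ℂ (QutGen ι))ᵐᵒᵖ :=
  letI : Algebra ℂ (FreeAlgebra ℂ (QutGen ι))ᵐᵒᵖ :=
    Algebra.compHom (FreeAlgebra ℂ (QutGen ι))ᵐᵒᵖ (starRingEnd ℂ)
  (FreeAlgebra.lift ℂ fun g : QutGen ι => MulOpposite.op (FreeAlgebra.ι ℂ g.bar)).toRingHom

theorem freeStar_ι {ι : Type v} (g : QutGen ι) :
    freeStar ι (FreeAlgebra.ι ℂ g) = MulOpposite.op (FreeAlgebra.ι ℂ g.bar) := by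
  let : Algebra ℂ (FreeAlgebra ℂ (QutGen ι))ᵐᵒᵖ :=
    Algebra.compHom (FreeAlgebra ℂ (QutGen ι))ᵐᵒᵖ (starRingEnd ℂ)
  exact FreeAlgebra.lift_ι_apply _ _

theorem freeStar_algebraMap {ι : Type v} (c : ℂ) :
    freeStar ι (algebraMap ℂ _ c) = MulOpposite.op (algebraMap ℂ _ (starRingEnd ℂ c)) := by
  let : Algebra ℂ (FreeAlgebra ℂ (QutGen ι))ᵐᵒᵖ :=
    Algebra.compHom (FreeAlgebra ℂ (QutGen ι))ᵐᵒᵖ (starRingEnd ℂ)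
  exact AlgHom.commutes (FreeAlgebra.lift ℂ
    fun g : QutGen ι => MulOpposite.op (FreeAlgebra.ι ℂ g.bar)) c

end QutGen

namespace FiniteQuantumSet

variable {C : Type u} [CStarAlgebra C] {ι : Type v} [Fintype ι] [DecidableEq ι] {κ : Type w}

/-- The structure constants `bᵢ bₖ = ∑ₚ mulCoeff p i k bₚ`. -/
def mulCoeff (X : FiniteQuantumSet C ι) (p i k : ι) : ℂ := X.basis.repr (X.basis i * X.basis k) p

/-- The coordinates of the unit, `η = ∑ᵢ unitCoeff i bᵢ`. -/
def unitCoeff (X : FiniteQuantumSet C ι) (i : ι) : ℂ := X.basis.repr 1 i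

/-- The matrix entries of an operator on `ℓ²(𝕏)`, `A bⱼ = ∑ᵢ opCoeff A i j bᵢ`. -/
def opCoeff (X : FiniteQuantumSet C ι) (A : C →ₗ[ℂ] C) (i j : ι) : ℂ :=
  X.basis.repr (A (X.basis j)) i

/-- The matrix `U`, with entries in a `*`-algebra and regarded as a matrix acting on `ℓ²(𝕏)`,
satisfies: `U` is unitary, `m (U ⊗ U) = U m`, `U η = η` and `U A_k = A_k U` for all `k`. -/
structure IsQutMatrix (X : FiniteQuantumSet C ι) (A : κ → C →ₗ[ℂ] C)
    {R : Type*} [Ring R] [StarRing R] [Algebra ℂ R] (U : ι → ι → R) : Prop where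
  unitary_left : ∀ i j, ∑ k, star (U k i) * U k j = if i = j then 1 else 0
  unitary_right : ∀ i j, ∑ k, U i k * star (U j k) = if i = j then 1 else 0
  mul : ∀ p j l, ∑ i, ∑ k, X.mulCoeff p i k • (U i j * U k l) = ∑ q, X.mulCoeff q j l • U p q
  unit : ∀ i, ∑ j, X.unitCoeff j • U i j = X.unitCoeff i • 1
  comm : ∀ k i j, ∑ p, X.opCoeff (A k) p j • U i p = ∑ p, X.opCoeff (A k) i p • U p j

/-- The relations of `IsQutMatrix` for the matrix of generators in the free `*`-algebra, together
with their adjoints. -/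
inductive QutRel (X : FiniteQuantumSet C ι) (A : κ → C →ₗ[ℂ] C) :
    FreeAlgebra ℂ (QutGen ι) → FreeAlgebra ℂ (QutGen ι) → Prop
  | unitary_left (i j : ι) : QutRel X A
      (∑ k, FreeAlgebra.ι ℂ (QutGen.uStar k i) * FreeAlgebra.ι ℂ (QutGen.u k j))
      (if i = j then 1 else 0)
  | unitary_right (i j : ι) : QutRel X A
      (∑ k, FreeAlgebra.ι ℂ (QutGen.u i k) * FreeAlgebra.ι ℂ (QutGen.uStar j k))
      (if i = j then 1 else 0)
  | mul (p j l : ι) : QutRel X A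
      (∑ i, ∑ k, X.mulCoeff p i k •
        (FreeAlgebra.ι ℂ (QutGen.u i j) * FreeAlgebra.ι ℂ (QutGen.u k l)))
      (∑ q, X.mulCoeff q j l • FreeAlgebra.ι ℂ (QutGen.u p q))
  | unit (i : ι) : QutRel X A
      (∑ j, X.unitCoeff j • FreeAlgebra.ι ℂ (QutGen.u i j)) (X.unitCoeff i • 1)
  | comm (k : κ) (i j : ι) : QutRel X A
      (∑ p, X.opCoeff (A k) p j • FreeAlgebra.ι ℂ (QutGen.u i p))
      (∑ p, X.opCoeff (A k) i p • FreeAlgebra.ι ℂ (QutGen.u p j))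
  | star {x y : FreeAlgebra ℂ (QutGen ι)} (h : QutRel X A x y) : QutRel X A
      (QutGen.freeStar ι x).unop (QutGen.freeStar ι y).unop

/-- The universal `*`-algebra generated by the entries of a matrix `U` subject to the relations
of `IsQutMatrix`. For a single operator `A` it is `𝒪(Qut(𝕏, A))`; for a family `A` it is
`𝒪(⋂ₖ Qut(𝕏, A_k))`, the universal `*`-algebra generated by the `u i j` subject to the relations
of all the `Qut(𝕏, A_k)` (and `𝒪(Qut(𝕏))` if the family is empty). -/
def QutAlg (X : FiniteQuantumSet C ι) (A : κ → C →ₗ[ℂ] C) : Type v := RingQuot (X.QutRel A)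

namespace QutAlg

variable (X : FiniteQuantumSet C ι) (A : κ → C →ₗ[ℂ] C)

instance : Ring (X.QutAlg A) := inferInstanceAs (Ring (RingQuot (X.QutRel A)))

instance : Algebra ℂ (X.QutAlg A) := inferInstanceAs (Algebra ℂ (RingQuot (X.QutRel A)))

/-- The quotient map. -/
def mk : FreeAlgebra ℂ (QutGen ι) →ₐ[ℂ] X.QutAlg A := RingQuot.mkAlgHom ℂ (X.QutRel A)

theorem mk_surjective : Function.Surjective (mk X A) := RingQuot.mkAlgHom_surjective ℂ _

theorem mk_rel {x y : FreeAlgebra ℂ (QutGen ι)} (h : X.QutRel A x y) : mk X A x = mk X A y :=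
  RingQuot.mkAlgHom_rel ℂ h

/-- The adjoint operation as a ring homomorphism to the opposite ring. -/
def starHom : X.QutAlg A →+* (X.QutAlg A)ᵐᵒᵖ :=
  RingQuot.lift ⟨(RingHom.op (mk X A : FreeAlgebra ℂ (QutGen ι) →+* X.QutAlg A)).comp
    (QutGen.freeStar ι), fun _ _ h => congrArg MulOpposite.op (mk_rel X A h.star)⟩

theorem starHom_mk (x : FreeAlgebra ℂ (QutGen ι)) :
    starHom X A (mk X A x) = MulOpposite.op (mk X A (QutGen.freeStar ι x).unop) := by
  have h : mk X A x = RingQuot.mkRingHom (X.QutRel A) x :=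
    RingHom.congr_fun (RingQuot.mkAlgHom_coe ℂ (X.QutRel A)) x
  rw [h]
  exact RingQuot.lift_mkRingHom_apply _ _ _

theorem freeStar_freeStar (x : FreeAlgebra ℂ (QutGen ι)) :
    (QutGen.freeStar ι (QutGen.freeStar ι x).unop).unop = x := by
  induction x using FreeAlgebra.induction with
  | grade0 r => simp [QutGen.freeStar_algebraMap]
  | grade1 g => simp [QutGen.freeStar_ι, QutGen.bar_bar]
  | mul a b ha hb => simp [ha, hb]
  | add a b ha hb => simp [ha, hb]

instance : StarRing (X.QutAlg A) where
  star x := (starHom X A x).unop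
  star_involutive x := by
    obtain ⟨x, rfl⟩ := mk_surjective X A x
    simp only [starHom_mk, MulOpposite.unop_op, freeStar_freeStar]
  star_mul x y := by simp
  star_add x y := by simp

theorem star_mk (x : FreeAlgebra ℂ (QutGen ι)) :
    star (mk X A x) = mk X A (QutGen.freeStar ι x).unop :=
  congrArg MulOpposite.unop (starHom_mk X A x)

instance : StarModule ℂ (X.QutAlg A) where
  star_smul c x := by
    obtain ⟨x, rfl⟩ := mk_surjective X A x
    rw [← map_smul, star_mk, star_mk, Algebra.smul_def, map_mul, QutGen.freeStar_algebraMap,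
      MulOpposite.unop_mul, MulOpposite.unop_op, ← Algebra.commutes, ← Algebra.smul_def, map_smul]
    rfl

/-- The generators, i.e. the entries of the fundamental representation `U`. -/
def u (i j : ι) : X.QutAlg A := mk X A (FreeAlgebra.ι ℂ (QutGen.u i j))

theorem mk_uStar (i j : ι) :
    mk X A (FreeAlgebra.ι ℂ (QutGen.uStar i j)) = star (u X A i j) := by
  rw [u, star_mk, QutGen.freeStar_ι]
  rfl

theorem isQutMatrix_u : X.IsQutMatrix A (u X A) where
  unitary_left i j := by
    simpa [mk_uStar, u, apply_ite (mk X A)] using mk_rel X A (QutRel.unitary_left i j)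
  unitary_right i j := by
    simpa [mk_uStar, u, apply_ite (mk X A)] using mk_rel X A (QutRel.unitary_right i j)
  mul p j l := by simpa [u] using mk_rel X A (QutRel.mul p j l)
  unit i := by simpa [u] using mk_rel X A (QutRel.unit i)
  comm k i j := by simpa [u] using mk_rel X A (QutRel.comm k i j)

section lift

variable {X A} {R : Type*} [Ring R] [StarRing R] [Algebra ℂ R] [StarModule ℂ R] {U : ι → ι → R}

/-- The homomorphism of the free algebra given by a matrix `U`. -/
def freeLift (U : ι → ι → R) : FreeAlgebra ℂ (QutGen ι) →ₐ[ℂ] R :=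
  FreeAlgebra.lift ℂ fun g => match g with
    | QutGen.u i j => U i j
    | QutGen.uStar i j => star (U i j)

theorem freeLift_u (i j : ι) : freeLift U (FreeAlgebra.ι ℂ (QutGen.u i j)) = U i j :=
  FreeAlgebra.lift_ι_apply _ _

theorem freeLift_uStar (i j : ι) :
    freeLift U (FreeAlgebra.ι ℂ (QutGen.uStar i j)) = star (U i j) :=
  FreeAlgebra.lift_ι_apply _ _

theorem freeLift_freeStar (x : FreeAlgebra ℂ (QutGen ι)) :
    freeLift U (QutGen.freeStar ι x).unop = star (freeLift U x) := by
  induction x using FreeAlgebra.induction with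
  | grade0 r => 
    rw [QutGen.freeStar_algebraMap, MulOpposite.unop_op, AlgHom.commutes, AlgHom.commutes]
    exact algebraMap_star_comm r
  | grade1 g => cases g <;> simp [QutGen.freeStar_ι, QutGen.bar, freeLift_u, freeLift_uStar]
  | mul a b ha hb => simp [ha, hb]
  | add a b ha hb => simp [ha, hb]

theorem freeLift_rel (hU : X.IsQutMatrix A U) {x y : FreeAlgebra ℂ (QutGen ι)}
    (h : X.QutRel A x y) : freeLift U x = freeLift U y := by
  induction h with
  | unitary_left i j =>
    simpa [freeLift_u, freeLift_uStar, apply_ite (freeLift U)] using hU.unitary_left i j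
  | unitary_right i j =>
    simpa [freeLift_u, freeLift_uStar, apply_ite (freeLift U)] using hU.unitary_right i j
  | mul p j l => simpa [freeLift_u] using hU.mul p j l
  | unit i => simpa [freeLift_u] using hU.unit i
  | comm k i j => simpa [freeLift_u] using hU.comm k i j
  | star _ ih => rw [freeLift_freeStar, freeLift_freeStar, ih]

/-- The universal property: a matrix `U` with the required relations over a `*`-algebra `R` gives
a `*`-homomorphism to `R` that maps the generators to the entries of `U`. -/
def lift (hU : X.IsQutMatrix A U) : X.QutAlg A →⋆ₐ[ℂ] R :=
  let f : X.QutAlg A →ₐ[ℂ] R :=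
    RingQuot.liftAlgHom ℂ ⟨freeLift U, fun _ _ h => freeLift_rel hU h⟩
  { f with
    map_star' := fun x => by
      have key : ∀ y, f (mk X A y) = freeLift U y := fun y =>
        RingQuot.liftAlgHom_mkAlgHom_apply ℂ _ _ _
      obtain ⟨x, rfl⟩ := mk_surjective X A x
      change f (star (mk X A x)) = star (f (mk X A x))
      rw [star_mk, key, key, freeLift_freeStar] }

theorem lift_u (hU : X.IsQutMatrix A U) (i j : ι) : lift hU (u X A i j) = U i j :=
  (RingQuot.liftAlgHom_mkAlgHom_apply ℂ _ _ _).trans (freeLift_u i j)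

end lift

/-! The comultiplication `Δ (u i j) = ∑ₖ u i k ⊗ u k j` and the counit `ε (u i j) = δᵢⱼ`. -/

theorem sum_swap {M : Type*} [AddCommMonoid M] (F : ι → ι → ι → ι → M) :
    ∑ i, ∑ k, ∑ a, ∑ b, F i k a b = ∑ a, ∑ b, ∑ i, ∑ k, F i k a b := by
  calc _ = ∑ i, ∑ a, ∑ k, ∑ b, F i k a b := Finset.sum_congr rfl fun i _ => Finset.sum_comm
    _ = ∑ a, ∑ i, ∑ k, ∑ b, F i k a b := Finset.sum_comm
    _ = ∑ a, ∑ i, ∑ b, ∑ k, F i k a b := Finset.sum_congr rfl fun a _ =>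
        Finset.sum_congr rfl fun i _ => Finset.sum_comm
    _ = _ := Finset.sum_congr rfl fun a _ => Finset.sum_comm

theorem isQutMatrix_one : X.IsQutMatrix A fun i j => if i = j then (1 : ℂ) else 0 where
  unitary_left i j := by simp [apply_ite (starRingEnd ℂ), eq_comm (a := i)]
  unitary_right i j := by simp [apply_ite (starRingEnd ℂ)]
  mul p j l := by simp
  unit i := by simp
  comm k i j := by simp

theorem isQutMatrix_comul : X.IsQutMatrix A fun i j =>
    ∑ k, u X A i k ⊗ₜ[ℂ] u X A k j where
  unitary_left i j := by
    have h := isQutMatrix_u X A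
    calc _ = ∑ a, ∑ b, (∑ k, star (u X A k a) * u X A k b) ⊗ₜ[ℂ]
          (star (u X A a i) * u X A b j) := by
          simp only [star_sum, TensorProduct.star_tmul, Finset.sum_mul_sum,
            Algebra.TensorProduct.tmul_mul_tmul, TensorProduct.sum_tmul]
          rw [Finset.sum_comm]
          exact Finset.sum_congr rfl fun a _ => Finset.sum_comm
      _ = 1 ⊗ₜ[ℂ] ∑ a, star (u X A a i) * u X A a j := by
          rw [TensorProduct.tmul_sum]
          simp only [h.unitary_left, TensorProduct.ite_tmul, Finset.sum_ite_eq,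
            Finset.mem_univ, if_true]
      _ = _ := by
          rw [h.unitary_left]
          split_ifs <;> simp [Algebra.TensorProduct.one_def]
  unitary_right i j := by
    have h := isQutMatrix_u X A
    calc _ = ∑ a, ∑ b, (u X A i a * star (u X A j b)) ⊗ₜ[ℂ]
          (∑ k, u X A a k * star (u X A b k)) := by
          simp only [star_sum, TensorProduct.star_tmul, Finset.sum_mul_sum,
            Algebra.TensorProduct.tmul_mul_tmul, TensorProduct.tmul_sum]
          rw [Finset.sum_comm]
          exact Finset.sum_congr rfl fun a _ => Finset.sum_comm
      _ = (∑ a, u X A i a * star (u X A j a)) ⊗ₜ[ℂ] 1 := by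
          rw [TensorProduct.sum_tmul]
          simp only [h.unitary_right, TensorProduct.tmul_ite, Finset.sum_ite_eq,
            Finset.mem_univ, if_true]
      _ = _ := by
          rw [h.unitary_right]
          split_ifs <;> simp [Algebra.TensorProduct.one_def]
  mul p j l := by
    have h := isQutMatrix_u X A
    calc _ = ∑ a, ∑ b, (∑ i, ∑ k, X.mulCoeff p i k • (u X A i a * u X A k b)) ⊗ₜ[ℂ]
          (u X A a j * u X A b l) := by
          simp only [Finset.sum_mul_sum, Algebra.TensorProduct.tmul_mul_tmul,
            TensorProduct.sum_tmul, Finset.smul_sum, TensorProduct.smul_tmul']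
          exact sum_swap _
      _ = ∑ q, u X A p q ⊗ₜ[ℂ]
          ∑ a, ∑ b, X.mulCoeff q a b • (u X A a j * u X A b l) := by
          conv_lhs => simp only [h.mul]
          simp only [TensorProduct.sum_tmul, TensorProduct.tmul_sum,
            TensorProduct.tmul_smul, TensorProduct.smul_tmul']
          rw [Finset.sum_comm_cycle]
      _ = _ := by
          simp only [h.mul, TensorProduct.tmul_sum, TensorProduct.tmul_smul, Finset.smul_sum]
          exact Finset.sum_comm
  unit i := by
    have h := isQutMatrix_u X A
    calc _ = ∑ k, u X A i k ⊗ₜ[ℂ] ∑ j, X.unitCoeff j • u X A k j := by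
          simp only [TensorProduct.tmul_sum, TensorProduct.tmul_smul, Finset.smul_sum]
          exact Finset.sum_comm
      _ = (∑ k, X.unitCoeff k • u X A i k) ⊗ₜ[ℂ] 1 := by
          conv_lhs => simp only [h.unit]
          simp only [TensorProduct.sum_tmul, TensorProduct.tmul_smul,
            ← TensorProduct.smul_tmul']
      _ = _ := by rw [h.unit, ← TensorProduct.smul_tmul', Algebra.TensorProduct.one_def]
  comm k i j := by
    have h := isQutMatrix_u X A
    calc _ = ∑ a, u X A i a ⊗ₜ[ℂ] ∑ p, X.opCoeff (A k) p j • u X A a p := by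
          simp only [TensorProduct.tmul_sum, TensorProduct.tmul_smul, Finset.smul_sum]
          exact Finset.sum_comm
      _ = ∑ p, (∑ a, X.opCoeff (A k) a p • u X A i a) ⊗ₜ[ℂ] u X A p j := by
          conv_lhs => simp only [h.comm]
          simp only [TensorProduct.sum_tmul, TensorProduct.tmul_sum,
            TensorProduct.tmul_smul, TensorProduct.smul_tmul']
          exact Finset.sum_comm
      _ = _ := by
          simp only [h.comm, TensorProduct.sum_tmul, Finset.smul_sum, TensorProduct.smul_tmul']
          exact Finset.sum_comm

/-- The comultiplication, `Δ (u i j) = ∑ₖ u i k ⊗ u k j`. -/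
def comulHom : X.QutAlg A →⋆ₐ[ℂ] X.QutAlg A ⊗[ℂ] X.QutAlg A := lift (isQutMatrix_comul X A)

/-- The counit, `ε (u i j) = δᵢⱼ`. -/
def counitHom : X.QutAlg A →⋆ₐ[ℂ] ℂ := lift (isQutMatrix_one X A)

theorem comulHom_u (i j : ι) :
    comulHom X A (u X A i j) = ∑ k, u X A i k ⊗ₜ[ℂ] u X A k j := lift_u _ i j

theorem counitHom_u (i j : ι) : counitHom X A (u X A i j) = if i = j then 1 else 0 :=
  lift_u _ i j

theorem mk_ι (g : QutGen ι) : mk X A (FreeAlgebra.ι ℂ g) =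
    match g with
    | QutGen.u i j => u X A i j
    | QutGen.uStar i j => star (u X A i j) := by
  cases g with
  | u i j => rfl
  | uStar i j => exact mk_uStar X A i j

/-- Two algebra homomorphisms that agree on the generators and on their adjoints are equal. -/
theorem algHom_ext {R : Type*} [Ring R] [Algebra ℂ R] {f g : X.QutAlg A →ₐ[ℂ] R}
    (h : ∀ i j, f (u X A i j) = g (u X A i j))
    (h' : ∀ i j, f (star (u X A i j)) = g (star (u X A i j))) : f = g := by
  have : f.comp (mk X A) = g.comp (mk X A) := by
    apply FreeAlgebra.hom_ext
    funext x
    cases x with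
    | u i j => exact h i j
    | uStar i j =>
      simp only [Function.comp_apply, AlgHom.comp_apply, mk_uStar]
      exact h' i j
  ext x
  obtain ⟨x, rfl⟩ := mk_surjective X A x
  exact AlgHom.congr_fun this x

theorem comulHom_star_u (i j : ι) :
    comulHom X A (star (u X A i j)) =
      ∑ k, star (u X A i k) ⊗ₜ[ℂ] star (u X A k j) := by
  rw [map_star, comulHom_u, star_sum]
  rfl

theorem counitHom_star_u (i j : ι) :
    counitHom X A (star (u X A i j)) = if i = j then 1 else 0 := by
  rw [map_star, counitHom_u]
  split_ifs <;> simp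

instance : Bialgebra ℂ (X.QutAlg A) :=
  Bialgebra.ofAlgHom (comulHom X A).toAlgHom (counitHom X A).toAlgHom
    (by
      apply algHom_ext X A <;> intro i j
      · simp [comulHom_u, TensorProduct.sum_tmul, TensorProduct.tmul_sum]
        exact Finset.sum_comm
      · simp [comulHom_star_u, TensorProduct.sum_tmul, TensorProduct.tmul_sum]
        exact Finset.sum_comm)
    (by
      apply algHom_ext X A <;> intro i j
      · simp [comulHom_u, counitHom_u, TensorProduct.ite_tmul]
      · simp [comulHom_star_u, counitHom_star_u, TensorProduct.ite_tmul])
    (by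
      apply algHom_ext X A <;> intro i j
      · simp [comulHom_u, counitHom_u, TensorProduct.tmul_ite]
      · simp [comulHom_star_u, counitHom_star_u, TensorProduct.tmul_ite])

end QutAlg

end FiniteQuantumSet

/-! ### Combining a family of quantum graphs into one -/

/-- `B` is the adjacency matrix of an undirected graph (possibly with loops) on the set `V`. -/
structure IsGraphMatrix {V : Type v} (B : Matrix V V ℂ) : Prop where
  zero_or_one : ∀ k l, B k l = 0 ∨ B k l = 1
  symm : B.transpose = B

/-- The adjacency matrix of the graph without loops on `{0, …, 2 n}` in which distinct `k, l > 0`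
are connected if and only if `k + l > 2 n`, and `0` is connected to all `k > n`. -/
def thresholdMatrix (n : ℕ) : Matrix (Fin (2 * n + 1)) (Fin (2 * n + 1)) ℂ := fun k l =>
  if k ≠ l ∧ ((0 < k.val ∧ 0 < l.val ∧ 2 * n < k.val + l.val) ∨
    (k.val = 0 ∧ n < l.val) ∨ (l.val = 0 ∧ n < k.val)) then 1 else 0

/-- For the `i`-th index in `{1, …, n}` (element `i - 1` of `Fin n`), the vertex `2 i - 1`. -/
def oddVertex {n : ℕ} (i : Fin n) : Fin (2 * n + 1) := ⟨2 * i.val + 1, by omega⟩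

/-- For the `i`-th index in `{1, …, n}` (element `i - 1` of `Fin n`), the vertex `2 i`. -/
def evenVertex {n : ℕ} (i : Fin n) : Fin (2 * n + 1) := ⟨2 * i.val + 2, by omega⟩

namespace FiniteQuantumSet

variable {C : Type u} [CStarAlgebra C] {ι : Type v} [Fintype ι] [DecidableEq ι]

/-- The operator `I ⊗ B + ∑ᵢ (Aᵢ ⊗ E_{2i-1,2i} + Aᵢ* ⊗ E_{2i,2i-1})` on `ℓ²(𝕏) ⊗ ℂ^{2n+1}`, where
the `E_{k,l}` are the matrix units. -/
def combine (X : FiniteQuantumSet C ι) {n : ℕ} (A : Fin n → C →ₗ[ℂ] C)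
    (B : Matrix (Fin (2 * n + 1)) (Fin (2 * n + 1)) ℂ) :
    (Fin (2 * n + 1) → C) →ₗ[ℂ] (Fin (2 * n + 1) → C) :=
  tensorMatrix LinearMap.id B +
    ∑ i, (tensorMatrix (A i) (Matrix.single (oddVertex i) (evenVertex i) 1) +
      tensorMatrix (X.adjoint (A i)) (Matrix.single (evenVertex i) (oddVertex i) 1))

/-- `Qut(𝕏 ⊗ ℂᵐ, A') = ⋂ₖ Qut(𝕏, A_k)`: there is an isomorphism of `*`-algebras
`𝒪(Qut(𝕏 ⊗ ℂᵐ, A')) ≅ 𝒪(⋂ₖ Qut(𝕏, A_k))` that respects comultiplications and counits (an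
isomorphism of compact quantum groups), and it maps the fundamental representation of the left
side to `V ⊕ ⋯ ⊕ V` (`m` copies), i.e. to `V` tensored with the identity of `ℂᵐ`, where `V` is the
fundamental representation of the right side. -/
def QutEqInter {κ : Type w} (X : FiniteQuantumSet C ι) (A : κ → C →ₗ[ℂ] C) (m : ℕ)
    (A' : (Fin m → C) →ₗ[ℂ] (Fin m → C)) : Prop :=
  ∃ φ : (X.prod m).QutAlg (fun _ : Unit => A') ≃⋆ₐ[ℂ] X.QutAlg A,
    (∀ x, Coalgebra.comul (R := ℂ) (φ x) =
      TensorProduct.map φ.toAlgEquiv.toLinearMap φ.toAlgEquiv.toLinearMap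
        (Coalgebra.comul (R := ℂ) x)) ∧
    (∀ x, Coalgebra.counit (R := ℂ) (φ x) = Coalgebra.counit (R := ℂ) x) ∧
    ∀ (k l : Fin m) (i j : ι),
      φ (QutAlg.u (X.prod m) (fun _ : Unit => A') ⟨k, i⟩ ⟨l, j⟩) =
        if k = l then QutAlg.u X A i j else 0

end FiniteQuantumSet

end

noncomputable section

set_option linter.unusedSectionVars false
universe u v w

namespace FiniteQuantumSet

variable {C : Type u} [CStarAlgebra C] {ι : Type v} [Fintype ι] [DecidableEq ι]

/-! ### Operators on a finite quantum set -/

theorem psi_star_mul (X : FiniteQuantumSet C ι) (x y : C) :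
    X.psi (star x * y) = ∑ i, star (X.basis.repr x i) * X.basis.repr y i := by
  conv_lhs => rw [← X.basis.sum_repr x, ← X.basis.sum_repr y]
  simp only [star_sum, star_smul, Finset.sum_mul_sum, smul_mul_smul_comm, map_sum, map_smul,
    X.orthonormal, smul_eq_mul, mul_ite, mul_one, mul_zero, Finset.sum_ite_eq, Finset.mem_univ,
    if_true]

theorem repr_apply (X : FiniteQuantumSet C ι) (x : C) (i : ι) :
    X.basis.repr x i = X.psi (star (X.basis i) * x) := by
  rw [psi_star_mul, Finset.sum_eq_single i] <;>
    simp +contextual [eq_comm]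

theorem psi_star (X : FiniteQuantumSet C ι) (x : C) : X.psi (star x) = star (X.psi x) := by
  have h₁ := X.psi_star_mul x 1
  have h₂ := X.psi_star_mul 1 x
  rw [mul_one] at h₁
  rw [star_one, one_mul] at h₂
  rw [h₁, h₂, star_sum]
  simp [mul_comm]

theorem sum_psi_smul (X : FiniteQuantumSet C ι) (x : C) :
    ∑ i, X.psi (star (X.basis i) * x) • X.basis i = x := by
  simp only [← repr_apply, X.basis.sum_repr]

theorem mulAdjoint_apply (X : FiniteQuantumSet C ι) (x : C) :
    mulAdjoint X.psi X.basis x = ∑ i, X.basis i ⊗ₜ[ℂ] (star (X.basis i) * x) := by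
  simp only [mulAdjoint, LinearMap.sum_apply, LinearMap.smulRight_apply, LinearMap.comp_apply,
    LinearMap.mulLeft_apply, star_mul, mul_assoc]
  refine Finset.sum_congr rfl fun i _ => ?_
  conv_rhs => rw [← X.sum_psi_smul (star (X.basis i) * x)]
  simp [TensorProduct.tmul_sum]

theorem mulAdjoint_apply' (X : FiniteQuantumSet C ι) (x : C) :
    mulAdjoint X.psi X.basis x = ∑ i, (x * star (X.basis i)) ⊗ₜ[ℂ] X.basis i := by
  simp only [mulAdjoint, LinearMap.sum_apply, LinearMap.smulRight_apply, LinearMap.comp_apply,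
    LinearMap.mulLeft_apply, star_mul, mul_assoc]
  rw [Finset.sum_comm]
  refine Finset.sum_congr rfl fun j _ => ?_
  conv_rhs => rw [← X.sum_psi_smul (x * star (X.basis j))]
  simp only [TensorProduct.sum_tmul, TensorProduct.smul_tmul']
  refine Finset.sum_congr rfl fun i _ => ?_
  rw [X.psi_tracial, mul_assoc]

theorem schur_apply (X : FiniteQuantumSet C ι) (A B : C →ₗ[ℂ] C) (x : C) :
    X.schur A B x = ∑ i, A (X.basis i) * B (star (X.basis i) * x) := by
  simp [schur, mulAdjoint_apply]

theorem schur_apply' (X : FiniteQuantumSet C ι) (A B : C →ₗ[ℂ] C) (x : C) :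
    X.schur A B x = ∑ i, A (x * star (X.basis i)) * B (X.basis i) := by
  simp [schur, mulAdjoint_apply']

theorem schur_add_left (X : FiniteQuantumSet C ι) (A A' B : C →ₗ[ℂ] C) :
    X.schur (A + A') B = X.schur A B + X.schur A' B := by
  ext x; simp [schur_apply, add_mul, Finset.sum_add_distrib]

theorem schur_add_right (X : FiniteQuantumSet C ι) (A B B' : C →ₗ[ℂ] C) :
    X.schur A (B + B') = X.schur A B + X.schur A B' := by
  ext x; simp [schur_apply, mul_add, Finset.sum_add_distrib]

theorem schur_zero_left (X : FiniteQuantumSet C ι) (B : C →ₗ[ℂ] C) : X.schur 0 B = 0 := by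
  ext x; simp [schur_apply]

theorem schur_zero_right (X : FiniteQuantumSet C ι) (A : C →ₗ[ℂ] C) : X.schur A 0 = 0 := by
  ext x; simp [schur_apply]

theorem schur_id_id (X : FiniteQuantumSet C ι) :
    X.schur LinearMap.id LinearMap.id = LinearMap.id := by
  rw [schur, TensorProduct.map_id, LinearMap.id_comp]
  exact X.one_form

theorem opCoeff_eq (X : FiniteQuantumSet C ι) (A : C →ₗ[ℂ] C) (i j : ι) :
    X.opCoeff A i j = LinearMap.toMatrix X.basis X.basis A i j := by
  rw [LinearMap.toMatrix_apply]; rfl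

theorem op_ext (X : FiniteQuantumSet C ι) {A B : C →ₗ[ℂ] C}
    (h : ∀ i j, X.opCoeff A i j = X.opCoeff B i j) : A = B := by
  apply (LinearMap.toMatrix X.basis X.basis).injective
  ext i j
  rw [← opCoeff_eq, ← opCoeff_eq, h]

theorem opCoeff_adjoint (X : FiniteQuantumSet C ι) (A : C →ₗ[ℂ] C) (i j : ι) :
    X.opCoeff (X.adjoint A) i j = star (X.opCoeff A j i) := by
  rw [opCoeff_eq, opCoeff_eq, adjoint, LinearMap.toMatrix_toLin, Matrix.conjTranspose_apply]

theorem opCoeff_add (X : FiniteQuantumSet C ι) (A B : C →ₗ[ℂ] C) (i j : ι) :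
    X.opCoeff (A + B) i j = X.opCoeff A i j + X.opCoeff B i j := by
  simp [opCoeff]

theorem opCoeff_smul (X : FiniteQuantumSet C ι) (c : ℂ) (A : C →ₗ[ℂ] C) (i j : ι) :
    X.opCoeff (c • A) i j = c * X.opCoeff A i j := by
  simp [opCoeff]

theorem opCoeff_id (X : FiniteQuantumSet C ι) (i j : ι) :
    X.opCoeff LinearMap.id i j = if i = j then 1 else 0 := by
  simp [opCoeff, Finsupp.single_apply, eq_comm]

theorem repr_op (X : FiniteQuantumSet C ι) (A : C →ₗ[ℂ] C) (x : C) (i : ι) :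
    X.basis.repr (A x) i = ∑ j, X.opCoeff A i j * X.basis.repr x j := by
  conv_lhs => rw [← X.basis.sum_repr x]
  simp only [map_sum, map_smul, Finsupp.finsetSum_apply, Finsupp.smul_apply, smul_eq_mul, opCoeff,
    mul_comm]

theorem repr_mul (X : FiniteQuantumSet C ι) (x y : C) (p : ι) :
    X.basis.repr (x * y) p =
      ∑ i, ∑ k, X.mulCoeff p i k * (X.basis.repr x i * X.basis.repr y k) := by
  conv_lhs => rw [← X.basis.sum_repr x, ← X.basis.sum_repr y]
  simp only [Finset.sum_mul_sum, smul_mul_smul_comm, map_sum, map_smul, Finsupp.finsetSum_apply,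
    Finsupp.smul_apply, smul_eq_mul, mulCoeff, mul_comm]

theorem opCoeff_schur (X : FiniteQuantumSet C ι) (A B : C →ₗ[ℂ] C) (p q : ι) :
    X.opCoeff (X.schur A B) p q = ∑ i, ∑ j, ∑ k, ∑ l,
      X.mulCoeff p k l * (X.opCoeff A k i * X.opCoeff B l j) * star (X.mulCoeff q i j) := by
  have h : ∀ i j, X.psi (star (X.basis i * X.basis j) * X.basis q) = star (X.mulCoeff q i j) := by
    intro i j
    rw [mulCoeff, repr_apply, ← psi_star, star_mul (star _), star_star]
  simp only [opCoeff, schur, mulAdjoint, LinearMap.comp_apply, LinearMap.sum_apply,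
    LinearMap.smulRight_apply, LinearMap.mulLeft_apply, h, map_sum, map_smul,
    TensorProduct.map_tmul, LinearMap.mul'_apply, Finsupp.smul_apply,
    Finsupp.finsetSum_apply, repr_mul, smul_eq_mul, Finset.mul_sum]
  simp only [mul_comm]

theorem adjoint_schur (X : FiniteQuantumSet C ι) (A B : C →ₗ[ℂ] C) :
    X.adjoint (X.schur A B) = X.schur (X.adjoint A) (X.adjoint B) := by
  apply X.op_ext
  intro p q
  simp only [opCoeff_adjoint, opCoeff_schur, star_sum, star_mul', star_star]
  rw [QutAlg.sum_swap]
  refine Finset.sum_congr rfl fun i _ => Finset.sum_congr rfl fun j _ =>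
    Finset.sum_congr rfl fun k _ => Finset.sum_congr rfl fun l _ => ?_
  ring

theorem adjoint_adjoint (X : FiniteQuantumSet C ι) (A : C →ₗ[ℂ] C) :
    X.adjoint (X.adjoint A) = A :=
  X.op_ext fun i j => by simp [opCoeff_adjoint]

theorem adjoint_add (X : FiniteQuantumSet C ι) (A B : C →ₗ[ℂ] C) :
    X.adjoint (A + B) = X.adjoint A + X.adjoint B :=
  X.op_ext fun i j => by simp [opCoeff_adjoint, opCoeff_add]

theorem adjoint_smul (X : FiniteQuantumSet C ι) (c : ℂ) (A : C →ₗ[ℂ] C) :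
    X.adjoint (c • A) = star c • X.adjoint A :=
  X.op_ext fun i j => by simp [opCoeff_adjoint, opCoeff_smul]

theorem adjoint_id (X : FiniteQuantumSet C ι) : X.adjoint LinearMap.id = LinearMap.id :=
  X.op_ext fun i j => by simp [opCoeff_adjoint, opCoeff_id, apply_ite (starRingEnd ℂ), eq_comm]

theorem adjoint_zero (X : FiniteQuantumSet C ι) : X.adjoint 0 = 0 :=
  X.op_ext fun i j => by rw [opCoeff_adjoint]; simp [opCoeff]

theorem psi_mul_adjoint (X : FiniteQuantumSet C ι) (A : C →ₗ[ℂ] C) (x y : C) :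
    X.psi (star x * X.adjoint A y) = X.psi (star (A x) * y) := by
  simp only [psi_star_mul, repr_op, opCoeff_adjoint, Finset.mul_sum, star_sum, Finset.sum_mul,
    star_mul']
  rw [Finset.sum_comm]
  refine Finset.sum_congr rfl fun i _ => Finset.sum_congr rfl fun j _ => ?_
  ring

theorem eq_of_psi (X : FiniteQuantumSet C ι) {x y : C}
    (h : ∀ z, X.psi (star z * x) = X.psi (star z * y)) : x = y :=
  X.basis.ext_elem fun i => by rw [repr_apply, repr_apply, h]

theorem psi_star_comm (X : FiniteQuantumSet C ι) (x y : C) :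
    X.psi (star x * y) = star (X.psi (x * star y)) := by
  rw [← psi_star, star_mul, star_star, X.psi_tracial]

theorem IsQuantumGraph.adjoint {X : FiniteQuantumSet C ι} {A : C →ₗ[ℂ] C}
    (h : X.IsQuantumGraph A) : X.IsQuantumGraph (X.adjoint A) where
  schur_self := by rw [← adjoint_schur, h.schur_self]
  real f := by
    apply X.eq_of_psi
    intro z
    have h₁ := X.psi_mul_adjoint A (star z) (star f)
    rw [star_star] at h₁
    rw [psi_star_comm, star_star, h₁, psi_mul_adjoint, ← psi_star, star_mul, star_star, star_star,
      X.psi_tracial, ← h.real (star z), star_star]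

theorem NoLoops.adjoint {X : FiniteQuantumSet C ι} {A : C →ₗ[ℂ] C}
    (h : X.NoLoops A) : X.NoLoops (X.adjoint A) := by
  unfold NoLoops at h ⊢
  rw [← X.adjoint_id, ← adjoint_schur, h, adjoint_zero]

/-- For an operator that equals its complex conjugate, `A • I = 0` implies `I • A = 0`. -/
theorem NoLoops.schur_id_left {X : FiniteQuantumSet C ι} {A : C →ₗ[ℂ] C}
    (h : X.NoLoops A) (hA : X.IsQuantumGraph A) : X.schur LinearMap.id A = 0 := by
  have hs : ∑ i, A (star (X.basis i)) * X.basis i = 0 := by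
    simpa [schur_apply'] using LinearMap.congr_fun h 1
  have hr : ∀ y, star (A y) = A (star y) := fun y => by rw [← hA.real (star y), star_star]
  ext x
  apply star_injective
  simp only [schur_apply', LinearMap.id_apply, star_sum, star_mul, star_star, hr,
    LinearMap.zero_apply, star_zero, ← mul_assoc, ← Finset.sum_mul, hs, zero_mul]

theorem IsQuantumGraph.psi_apply_one {X : FiniteQuantumSet C ι} {A : C →ₗ[ℂ] C}
    (h : X.IsQuantumGraph A) :
    X.psi (A 1) = ∑ i, X.psi (star (A (X.basis i)) * A (X.basis i)) := by
  conv_lhs => rw [← h.schur_self, schur_apply]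
  rw [map_sum]
  refine Finset.sum_congr rfl fun i _ => ?_
  rw [X.psi_tracial, mul_one, ← h.real (star (X.basis i)), star_star]

theorem psi_one_ne_zero [Nontrivial C] (X : FiniteQuantumSet C ι) : X.psi 1 ≠ 0 := fun h =>
  one_ne_zero (X.psi_faithful 1 (by rwa [star_one, one_mul]))

/-- The degree of a regular quantum graph is nonnegative. -/
theorem IsRegular.nonneg [Nontrivial C] {X : FiniteQuantumSet C ι} {A : C →ₗ[ℂ] C} {d : ℂ}
    (hd : X.IsRegular A d) (h : X.IsQuantumGraph A) : 0 ≤ d := by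
  have h₁ : 0 ≤ X.psi 1 := by simpa using X.psi_nonneg 1
  have h₂ : 0 ≤ d * X.psi 1 := by
    rw [← smul_eq_mul, ← map_smul, ← hd.1, h.psi_apply_one]
    exact Finset.sum_nonneg fun i _ => X.psi_nonneg _
  have h₃ : d = d * X.psi 1 * (X.psi 1)⁻¹ := by
    rw [mul_assoc, mul_inv_cancel₀ X.psi_one_ne_zero, mul_one]
  rw [h₃]
  exact mul_nonneg h₂ (inv_nonneg_of_nonneg h₁)

/-- A `0`-regular quantum graph is empty. -/
theorem IsRegular.eq_zero {X : FiniteQuantumSet C ι} {A : C →ₗ[ℂ] C}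
    (hd : X.IsRegular A 0) (h : X.IsQuantumGraph A) : A = 0 := by
  have h₁ := h.psi_apply_one
  rw [hd.1, zero_smul, map_zero, eq_comm,
    Finset.sum_eq_zero_iff_of_nonneg fun i _ => X.psi_nonneg _] at h₁
  exact X.basis.ext fun i => X.psi_faithful _ (h₁ i (Finset.mem_univ i))

end FiniteQuantumSet

namespace FiniteQuantumSet

variable {C : Type u} [CStarAlgebra C] {ι : Type v} [Fintype ι] [DecidableEq ι]

/-! ### Operators on `ℓ²(𝕏) ⊗ ℂᵐ` as block matrices -/

/-- The block `(k, l)` of an operator on `ℓ²(𝕏) ⊗ ℂᵐ`. -/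
def block {m : ℕ} (T : (Fin m → C) →ₗ[ℂ] (Fin m → C)) (k l : Fin m) : C →ₗ[ℂ] C :=
  LinearMap.proj k ∘ₗ T ∘ₗ LinearMap.single ℂ (fun _ : Fin m => C) l

theorem block_apply {m : ℕ} (T : (Fin m → C) →ₗ[ℂ] (Fin m → C)) (k l : Fin m) (x : C) :
    block T k l x = T (Pi.single l x) k := rfl

theorem apply_eq_sum_block {m : ℕ} (T : (Fin m → C) →ₗ[ℂ] (Fin m → C)) (f : Fin m → C)
    (k : Fin m) : T f k = ∑ l, block T k l (f l) := by
  conv_lhs => rw [← Finset.univ_sum_single f]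
  simp [map_sum, Finset.sum_apply, block_apply]

theorem block_add {m : ℕ} (S T : (Fin m → C) →ₗ[ℂ] (Fin m → C)) (k l : Fin m) :
    block (S + T) k l = block S k l + block T k l := rfl

theorem block_sum {m : ℕ} {σ : Type*} (s : Finset σ) (T : σ → (Fin m → C) →ₗ[ℂ] (Fin m → C))
    (k l : Fin m) : block (∑ i ∈ s, T i) k l = ∑ i ∈ s, block (T i) k l := by
  ext x; simp [block_apply, LinearMap.sum_apply, Finset.sum_apply]

theorem block_id {m : ℕ} (k l : Fin m) :
    block (LinearMap.id : (Fin m → C) →ₗ[ℂ] (Fin m → C)) k l =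
      if k = l then LinearMap.id else 0 := by
  ext x
  by_cases h : k = l
  · subst h; simp [block_apply]
  · simp [block_apply, h]

theorem block_tensorMatrix {m : ℕ} (T : C →ₗ[ℂ] C) (M : Matrix (Fin m) (Fin m) ℂ) (k l : Fin m) :
    block (tensorMatrix T M) k l = M k l • T := by
  ext x
  simp only [block_apply, tensorMatrix, LinearMap.pi_apply, LinearMap.sum_apply,
    LinearMap.smul_apply, LinearMap.comp_apply, LinearMap.proj_apply]
  rw [Finset.sum_eq_single l] <;> simp +contextual

theorem ext_block {m : ℕ} {S T : (Fin m → C) →ₗ[ℂ] (Fin m → C)}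
    (h : ∀ k l, block S k l = block T k l) : S = T := by
  refine LinearMap.ext fun f => funext fun k => ?_
  simp only [apply_eq_sum_block, h]

theorem prod_basis (X : FiniteQuantumSet C ι) (m : ℕ) (k : Fin m) (i : ι) :
    (X.prod m).basis ⟨k, i⟩ = Pi.single k (X.basis i) :=
  Pi.basis_apply _ _

theorem prod_repr (X : FiniteQuantumSet C ι) (m : ℕ) (f : Fin m → C) (k : Fin m) (i : ι) :
    (X.prod m).basis.repr f ⟨k, i⟩ = X.basis.repr (f k) i :=
  Pi.basis_repr _ _ _

theorem prod_opCoeff (X : FiniteQuantumSet C ι) (m : ℕ) (T : (Fin m → C) →ₗ[ℂ] (Fin m → C))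
    (k l : Fin m) (i j : ι) :
    (X.prod m).opCoeff T ⟨k, i⟩ ⟨l, j⟩ = X.opCoeff (block T k l) i j := by
  rw [opCoeff, prod_repr, prod_basis]; rfl

theorem prod_unitCoeff (X : FiniteQuantumSet C ι) (m : ℕ) (k : Fin m) (i : ι) :
    (X.prod m).unitCoeff ⟨k, i⟩ = X.unitCoeff i := by
  rw [unitCoeff, prod_repr]; rfl

theorem single_mul_single {m : ℕ} (k l : Fin m) (x y : C) :
    (Pi.single k x : Fin m → C) * Pi.single l y = if k = l then Pi.single k (x * y) else 0 := by
  split_ifs with h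
  · subst h
    rw [← Pi.single_mul]
  · ext p
    by_cases hp : p = k
    · subst hp
      simp [Pi.single_eq_of_ne h]
    · simp [Pi.single_eq_of_ne hp]

theorem prod_mulCoeff (X : FiniteQuantumSet C ι) (m : ℕ) (q k l : Fin m) (p i j : ι) :
    (X.prod m).mulCoeff ⟨q, p⟩ ⟨k, i⟩ ⟨l, j⟩ =
      if k = l ∧ q = k then X.mulCoeff p i j else 0 := by
  rw [mulCoeff, prod_repr, prod_basis, prod_basis, single_mul_single]
  by_cases h : k = l
  · by_cases hq : q = k
    · subst hq; simp [h, mulCoeff]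
    · rw [if_pos h, Pi.single_eq_of_ne hq, if_neg fun h => hq h.2]; simp
  · simp [h]

theorem block_schur (X : FiniteQuantumSet C ι) (m : ℕ) (S T : (Fin m → C) →ₗ[ℂ] (Fin m → C))
    (k l : Fin m) :
    block ((X.prod m).schur S T) k l = X.schur (block S k l) (block T k l) := by
  ext x
  have hs : ∀ (k : Fin m) (y : C), star (Pi.single k y : Fin m → C) = Pi.single k (star y) :=
    fun k y => by
      ext p
      by_cases hp : p = k
      · subst hp; simp
      · simp [Pi.single_eq_of_ne hp]
  simp only [block_apply, schur_apply, Fintype.sum_sigma, Finset.sum_apply, Pi.mul_apply,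
    prod_basis, hs, single_mul_single]
  rw [Finset.sum_eq_single l] <;> simp +contextual

theorem block_adjoint (X : FiniteQuantumSet C ι) (m : ℕ) (T : (Fin m → C) →ₗ[ℂ] (Fin m → C))
    (k l : Fin m) : block ((X.prod m).adjoint T) k l = X.adjoint (block T l k) :=
  X.op_ext fun i j => by
    rw [← prod_opCoeff, opCoeff_adjoint, opCoeff_adjoint, prod_opCoeff]

theorem isQuantumGraph_prod (X : FiniteQuantumSet C ι) {m : ℕ}
    {T : (Fin m → C) →ₗ[ℂ] (Fin m → C)} (h : ∀ k l, X.IsQuantumGraph (block T k l)) :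
    (X.prod m).IsQuantumGraph T where
  schur_self := ext_block fun k l => by rw [block_schur, (h k l).schur_self]
  real f := by
    ext k
    simp only [Pi.star_apply, apply_eq_sum_block, star_sum, (h k _).real]

/-! ### The blocks of the combined quantum graph -/

theorem IsQuantumGraph.zero (X : FiniteQuantumSet C ι) : X.IsQuantumGraph 0 where
  schur_self := X.schur_zero_left 0
  real f := by simp

theorem IsQuantumGraph.id_add {X : FiniteQuantumSet C ι} {A : C →ₗ[ℂ] C}
    (h : X.IsQuantumGraph A) (hl : X.NoLoops A) : X.IsQuantumGraph (LinearMap.id + A) where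
  schur_self := by
    have hl' : X.schur A LinearMap.id = 0 := hl
    rw [schur_add_left, schur_add_right, schur_add_right, schur_id_id, hl', h.schur_self,
      hl.schur_id_left h, add_zero, zero_add]
  real f := by simp [h.real]

theorem IsQuantumGraph.smul_id_add {X : FiniteQuantumSet C ι} {A : C →ₗ[ℂ] C}
    (h : X.IsQuantumGraph A) (hl : X.NoLoops A) {b : ℂ} (hb : b = 0 ∨ b = 1) :
    X.IsQuantumGraph (b • LinearMap.id + A) := by
  rcases hb with rfl | rfl
  · simpa using h
  · simpa using h.id_add hl

end FiniteQuantumSet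

/-- The vertices `2 i - 1` and `2 i`, in either order, are paired. -/
def Paired {n : ℕ} (k l : Fin (2 * n + 1)) : Prop :=
  ∃ i : Fin n, (k = oddVertex i ∧ l = evenVertex i) ∨ (k = evenVertex i ∧ l = oddVertex i)

theorem oddVertex_injective {n : ℕ} : Function.Injective (oddVertex (n := n)) := fun i j h => by
  simp only [oddVertex, Fin.mk.injEq] at h
  omega

theorem evenVertex_injective {n : ℕ} : Function.Injective (evenVertex (n := n)) := fun i j h => by
  simp only [evenVertex, Fin.mk.injEq] at h
  omega

theorem oddVertex_ne_evenVertex {n : ℕ} (i j : Fin n) : oddVertex i ≠ evenVertex j := fun h => by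
  simp only [oddVertex, evenVertex, Fin.mk.injEq] at h
  omega

theorem Paired.ne {n : ℕ} {k l : Fin (2 * n + 1)} (h : Paired k l) : k ≠ l := by
  obtain ⟨i, ⟨rfl, rfl⟩ | ⟨rfl, rfl⟩⟩ := h
  · exact oddVertex_ne_evenVertex i i
  · exact (oddVertex_ne_evenVertex i i).symm

namespace FiniteQuantumSet

variable {C : Type u} [CStarAlgebra C] {ι : Type v} [Fintype ι] [DecidableEq ι]
  (X : FiniteQuantumSet C ι) {n : ℕ} (A : Fin n → C →ₗ[ℂ] C)
  (B : Matrix (Fin (2 * n + 1)) (Fin (2 * n + 1)) ℂ)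

theorem block_combine (k l : Fin (2 * n + 1)) :
    block (X.combine A B) k l = B k l • LinearMap.id +
      ∑ i, ((if oddVertex i = k ∧ evenVertex i = l then A i else 0) +
        (if evenVertex i = k ∧ oddVertex i = l then X.adjoint (A i) else 0)) := by
  simp only [combine, block_add, block_sum, block_tensorMatrix, Matrix.single_apply, ite_smul,
    one_smul, zero_smul]

theorem block_combine_odd_even (i : Fin n) :
    block (X.combine A B) (oddVertex i) (evenVertex i) =
      B (oddVertex i) (evenVertex i) • LinearMap.id + A i := by
  simp [block_combine, oddVertex_injective.eq_iff, evenVertex_injective.eq_iff,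
    oddVertex_ne_evenVertex]

theorem block_combine_even_odd (i : Fin n) :
    block (X.combine A B) (evenVertex i) (oddVertex i) =
      B (evenVertex i) (oddVertex i) • LinearMap.id + X.adjoint (A i) := by
  simp [block_combine, oddVertex_injective.eq_iff, evenVertex_injective.eq_iff,
    oddVertex_ne_evenVertex]

theorem block_combine_of_not_paired {k l : Fin (2 * n + 1)} (h : ¬ Paired k l) :
    block (X.combine A B) k l = B k l • LinearMap.id := by
  rw [block_combine, Finset.sum_eq_zero, add_zero]
  intro i _
  rw [if_neg, if_neg, add_zero]
  · rintro ⟨rfl, rfl⟩; exact h ⟨i, Or.inr ⟨rfl, rfl⟩⟩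
  · rintro ⟨rfl, rfl⟩; exact h ⟨i, Or.inl ⟨rfl, rfl⟩⟩

variable {X A B}

theorem isQuantumGraph_combine (hA : ∀ i, X.IsQuantumGraph (A i)) (hl : ∀ i, X.NoLoops (A i))
    (hB : IsGraphMatrix B) : (X.prod (2 * n + 1)).IsQuantumGraph (X.combine A B) := by
  refine X.isQuantumGraph_prod fun k l => ?_
  by_cases h : Paired k l
  · obtain ⟨i, ⟨rfl, rfl⟩ | ⟨rfl, rfl⟩⟩ := h
    · rw [block_combine_odd_even]
      exact (hA i).smul_id_add (hl i) (hB.zero_or_one _ _)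
    · rw [block_combine_even_odd]
      exact (hA i).adjoint.smul_id_add (hl i).adjoint (hB.zero_or_one _ _)
  · rw [block_combine_of_not_paired X A B h, ← add_zero (B k l • _)]
    exact (IsQuantumGraph.zero X).smul_id_add (X.schur_zero_left _) (hB.zero_or_one _ _)

theorem isUndirected_combine (hB : IsGraphMatrix B) :
    (X.prod (2 * n + 1)).IsUndirected (X.combine A B) := by
  have hs : ∀ k l, star (B k l) = B l k := fun k l => by
    rw [← congrFun₂ hB.symm k l, Matrix.transpose_apply]
    rcases hB.zero_or_one l k with h | h <;> simp [h]
  refine ext_block fun k l => ?_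
  rw [block_adjoint]
  by_cases h : Paired k l
  · obtain ⟨i, ⟨rfl, rfl⟩ | ⟨rfl, rfl⟩⟩ := h
    · rw [block_combine_odd_even, block_combine_even_odd, adjoint_add, adjoint_smul, adjoint_id,
        adjoint_adjoint, hs]
    · rw [block_combine_odd_even, block_combine_even_odd, adjoint_add, adjoint_smul, adjoint_id,
        hs]
  · have h' : ¬ Paired l k := fun ⟨i, hi⟩ => h ⟨i, hi.symm.imp And.symm And.symm⟩
    rw [block_combine_of_not_paired X A B h, block_combine_of_not_paired X A B h', adjoint_smul,
      adjoint_id, hs]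

theorem noLoops_combine (hB : ∀ k, B k k = 0) :
    (X.prod (2 * n + 1)).NoLoops (X.combine A B) := by
  refine ext_block fun k l => ?_
  rw [block_schur, block_id]
  split_ifs with h
  · subst h
    rw [block_combine_of_not_paired X A B fun h => h.ne rfl, hB, zero_smul, schur_zero_left]
    rfl
  · rw [schur_zero_right]
    rfl

end FiniteQuantumSet

namespace FiniteQuantumSet

variable {C : Type u} [CStarAlgebra C] {ι : Type v} [Fintype ι] [DecidableEq ι] {κ : Type w}

/-! ### Intertwiners and fixed vectors -/

section Intertwiner

variable (X : FiniteQuantumSet C ι) {R : Type*} [Ring R] [StarRing R] [Algebra ℂ R]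
  (U : ι → ι → R)

/-- The operator `T` on `ℓ²(𝕏)` commutes with the matrix `U`. -/
def Intertwines (T : C →ₗ[ℂ] C) : Prop :=
  ∀ i j, ∑ p, X.opCoeff T p j • U i p = ∑ p, X.opCoeff T i p • U p j

/-- The vector `f` is fixed by the matrix `U`. -/
def IsFixed (f : C) : Prop :=
  ∀ i, ∑ j, X.basis.repr f j • U i j = X.basis.repr f i • 1

variable {X U}

theorem Intertwines.id : X.Intertwines U LinearMap.id := fun i j => by simp [opCoeff_id]

theorem Intertwines.add {S T : C →ₗ[ℂ] C} (hS : X.Intertwines U S) (hT : X.Intertwines U T) :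
    X.Intertwines U (S + T) := fun i j => by
  simp only [opCoeff_add, add_smul, Finset.sum_add_distrib, hS i j, hT i j]

theorem Intertwines.smul (c : ℂ) {T : C →ₗ[ℂ] C} (hT : X.Intertwines U T) :
    X.Intertwines U (c • T) := fun i j => by
  simp only [opCoeff_smul, mul_smul, ← Finset.smul_sum, hT i j]

theorem Intertwines.of_add {S T : C →ₗ[ℂ] C} (h : X.Intertwines U (S + T))
    (hS : X.Intertwines U S) : X.Intertwines U T := by
  simpa using h.add (hS.smul (-1))

theorem intertwines_iff (T : C →ₗ[ℂ] C) : X.Intertwines U T ↔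
    Matrix.of U * (Matrix.of (X.opCoeff T)).map (algebraMap ℂ R) =
      (Matrix.of (X.opCoeff T)).map (algebraMap ℂ R) * Matrix.of U := by
  rw [← Matrix.ext_iff]
  simp only [Intertwines, Matrix.mul_apply, Matrix.of_apply, Matrix.map_apply, Algebra.smul_def,
    Algebra.commutes]

theorem Intertwines.adjoint [StarModule ℂ R] {T : C →ₗ[ℂ] C} (hT : X.Intertwines U T)
    (h₁ : ∀ i j, ∑ k, star (U k i) * U k j = if i = j then 1 else 0)
    (h₂ : ∀ i j, ∑ k, U i k * star (U j k) = if i = j then 1 else 0) :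
    X.Intertwines U (X.adjoint T) := by
  rw [intertwines_iff] at hT ⊢
  have hD : (Matrix.of (X.opCoeff (X.adjoint T))).map (algebraMap ℂ R) =
      ((Matrix.of (X.opCoeff T)).map (algebraMap ℂ R)).conjTranspose := by
    ext i j
    simp only [Matrix.map_apply, Matrix.of_apply, opCoeff_adjoint, Matrix.conjTranspose_apply]
    exact algebraMap_star_comm _
  rw [hD]
  have hT' := congrArg Matrix.conjTranspose hT
  rw [Matrix.conjTranspose_mul, Matrix.conjTranspose_mul] at hT'
  generalize ((Matrix.of (X.opCoeff T)).map (algebraMap ℂ R)).conjTranspose = D at hT' ⊢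
  have h₁' : (Matrix.of U).conjTranspose * Matrix.of U = 1 := by
    ext i j; simp [Matrix.mul_apply, h₁, Matrix.one_apply]
  have h₂' : Matrix.of U * (Matrix.of U).conjTranspose = 1 := by
    ext i j; simp [Matrix.mul_apply, h₂, Matrix.one_apply]
  calc Matrix.of U * D
      = Matrix.of U * (D * (Matrix.of U).conjTranspose) * Matrix.of U := by
        rw [mul_assoc, mul_assoc, h₁', mul_one]
    _ = Matrix.of U * (Matrix.of U).conjTranspose * D * Matrix.of U := by
        rw [hT', mul_assoc, mul_assoc, mul_assoc, mul_assoc]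
    _ = D * Matrix.of U := by rw [h₂', one_mul]

theorem IsFixed.add {f g : C} (hf : X.IsFixed U f) (hg : X.IsFixed U g) :
    X.IsFixed U (f + g) := fun i => by
  simp only [map_add, Finsupp.add_apply, add_smul, Finset.sum_add_distrib, hf i, hg i]

theorem IsFixed.smul (c : ℂ) {f : C} (hf : X.IsFixed U f) : X.IsFixed U (c • f) := fun i => by
  simp only [map_smul, Finsupp.smul_apply, smul_eq_mul, mul_smul, ← Finset.smul_sum, hf i]

theorem IsFixed.map {f : C} {T : C →ₗ[ℂ] C} (hf : X.IsFixed U f) (hT : X.Intertwines U T) :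
    X.IsFixed U (T f) := fun i => by
  calc ∑ j, X.basis.repr (T f) j • U i j
      = ∑ p, X.basis.repr f p • ∑ j, X.opCoeff T j p • U i j := by
        simp only [repr_op, Finset.sum_smul, Finset.smul_sum, smul_smul]
        rw [Finset.sum_comm]
        simp only [mul_comm]
    _ = ∑ j, X.opCoeff T i j • ∑ p, X.basis.repr f p • U j p := by
        simp only [hT i _, Finset.smul_sum, smul_smul]
        rw [Finset.sum_comm]
        simp only [mul_comm]
    _ = _ := by simp only [hf _, repr_op, Finset.sum_smul, smul_smul]

variable {A : κ → C →ₗ[ℂ] C}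

theorem IsQutMatrix.isFixed_one (h : X.IsQutMatrix A U) : X.IsFixed U 1 := h.unit

theorem opCoeff_mulLeft (f : C) (p k : ι) :
    X.opCoeff (LinearMap.mulLeft ℂ f) p k = ∑ i, X.mulCoeff p i k * X.basis.repr f i := by
  rw [opCoeff, LinearMap.mulLeft_apply, repr_mul]
  refine Finset.sum_congr rfl fun i _ => ?_
  rw [Finset.sum_eq_single k] <;> simp +contextual [eq_comm]

/-- Multiplication by a fixed vector is an intertwiner. -/
theorem IsQutMatrix.intertwines_mulLeft (h : X.IsQutMatrix A U) {f : C} (hf : X.IsFixed U f) :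
    X.Intertwines U (LinearMap.mulLeft ℂ f) := fun p l => by
  calc _ = ∑ j, X.basis.repr f j • ∑ q, X.mulCoeff q j l • U p q := by
        simp only [opCoeff_mulLeft, Finset.sum_smul, Finset.smul_sum, smul_smul]
        rw [Finset.sum_comm]
        simp only [mul_comm]
    _ = ∑ i, ∑ k, X.mulCoeff p i k • ((∑ j, X.basis.repr f j • U i j) * U k l) := by
        simp only [← h.mul, Finset.smul_sum, Finset.sum_mul, smul_mul_assoc, smul_smul]
        rw [Finset.sum_comm]
        refine Finset.sum_congr rfl fun i _ => ?_
        rw [Finset.sum_comm]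
        simp only [mul_comm]
    _ = _ := by
        simp only [hf _, opCoeff_mulLeft, Finset.sum_smul, smul_mul_assoc, one_mul, smul_smul]
        rw [Finset.sum_comm]

theorem IsQutMatrix.isFixed_mul (h : X.IsQutMatrix A U) {f g : C} (hf : X.IsFixed U f)
    (hg : X.IsFixed U g) : X.IsFixed U (f * g) :=
  hg.map (h.intertwines_mulLeft hf)

theorem IsQutMatrix.intertwines (h : X.IsQutMatrix A U) (k : κ) : X.Intertwines U (A k) :=
  h.comm k

end Intertwiner

section Prod

variable {X : FiniteQuantumSet C ι} {R : Type*} [Ring R] [StarRing R] [Algebra ℂ R] {m : ℕ}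
  {U : (Σ _ : Fin m, ι) → (Σ _ : Fin m, ι) → R} {A : κ → (Fin m → C) →ₗ[ℂ] (Fin m → C)}

/-- The vectors `v` of `ℂᵐ` for which `η ⊗ v` is fixed form a subalgebra. -/
def fixedSubalgebra (h : (X.prod m).IsQutMatrix A U) : Subalgebra ℂ (Fin m → ℂ) where
  carrier := {v | (X.prod m).IsFixed U fun k => v k • (1 : C)}
  mul_mem' {v w} hv hw := by
    have := h.isFixed_mul hv hw
    simpa only [Set.mem_ofPred_eq, Pi.mul_def, smul_mul_smul_comm, mul_one] using this
  add_mem' {v w} hv hw := by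
    have := IsFixed.add hv hw
    simpa only [Set.mem_ofPred_eq, Pi.add_def, ← add_smul] using this
  algebraMap_mem' c := by
    have := h.isFixed_one.smul c
    exact this

theorem mem_fixedSubalgebra (h : (X.prod m).IsQutMatrix A U) (v : Fin m → ℂ) :
    v ∈ fixedSubalgebra h ↔ (X.prod m).IsFixed U fun k => v k • (1 : C) := Iff.rfl

theorem mulVec_mem_fixedSubalgebra (h : (X.prod m).IsQutMatrix A U) (a : κ)
    {M : Matrix (Fin m) (Fin m) ℂ} (hM : ∀ k l, block (A a) k l 1 = M k l • (1 : C))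
    {v : Fin m → ℂ} (hv : v ∈ fixedSubalgebra h) : M.mulVec v ∈ fixedSubalgebra h := by
  rw [mem_fixedSubalgebra] at hv ⊢
  convert hv.map (h.intertwines a) using 2 with k
  simp only [apply_eq_sum_block, map_smul, hM, smul_smul, ← Finset.sum_smul, Matrix.mulVec,
    dotProduct, mul_comm]

/-- If all vectors `η ⊗ v` are fixed, the matrix is block diagonal. -/
theorem eq_zero_of_fixedSubalgebra_eq_top (h : (X.prod m).IsQutMatrix A U)
    (htop : fixedSubalgebra h = ⊤) {k l : Fin m} (hkl : k ≠ l) (i j : ι) :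
    U ⟨k, i⟩ ⟨l, j⟩ = 0 := by
  have hk : (Pi.single k 1 : Fin m → ℂ) ∈ fixedSubalgebra h := htop ▸ Algebra.mem_top
  rw [mem_fixedSubalgebra] at hk
  have hint := h.intertwines_mulLeft hk ⟨k, i⟩ ⟨l, j⟩
  have hco : ∀ (a b : Fin m) (p q : ι), (X.prod m).opCoeff (LinearMap.mulLeft ℂ
      fun a => (Pi.single k 1 : Fin m → ℂ) a • (1 : C)) ⟨a, p⟩ ⟨b, q⟩ =
        if a = k ∧ a = b ∧ p = q then 1 else 0 := by
    intro a b p q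
    rw [opCoeff, prod_repr, prod_basis, LinearMap.mulLeft_apply, Pi.mul_apply]
    by_cases hb : a = b
    · subst hb
      by_cases ha : a = k
      · subst ha; simp [Finsupp.single_apply, eq_comm]
      · simp [ha]
    · simp [hb]
  simp only [hco, Fintype.sum_sigma, ite_smul, one_smul, zero_smul] at hint
  rw [Finset.sum_eq_zero, Finset.sum_eq_single k] at hint
  · rw [Finset.sum_eq_single i] at hint
    · simpa using hint.symm
    · intro p _ hp; simp [hp.symm]
    · simp
  · intro a _ ha; simp [ha.symm]
  · simp
  · intro a _
    refine Finset.sum_eq_zero fun p _ => if_neg ?_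
    rintro ⟨rfl, rfl, -⟩
    exact hkl rfl

theorem sum_sigma_eq_block {M : Type*} [AddCommMonoid M] (k : Fin m)
    (f : (Σ _ : Fin m, ι) → M) (hf : ∀ l i, l ≠ k → f ⟨l, i⟩ = 0) :
    ∑ x, f x = ∑ i, f ⟨k, i⟩ := by
  rw [Fintype.sum_sigma, Finset.sum_eq_single k]
  · exact fun l _ hl => Finset.sum_eq_zero fun i _ => hf l i hl
  · simp

/-- The relation between two diagonal blocks of `U` that is given by a block of an intertwiner. -/
theorem Intertwines.block {T : (Fin m → C) →ₗ[ℂ] (Fin m → C)}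
    (hT : (X.prod m).Intertwines U T) (hU : ∀ k l i j, k ≠ l → U ⟨k, i⟩ ⟨l, j⟩ = 0)
    (k l : Fin m) (i j : ι) :
    ∑ p, X.opCoeff (block T k l) p j • U ⟨k, i⟩ ⟨k, p⟩ =
      ∑ p, X.opCoeff (FiniteQuantumSet.block T k l) i p • U ⟨l, p⟩ ⟨l, j⟩ := by
  have h := hT ⟨k, i⟩ ⟨l, j⟩
  rw [sum_sigma_eq_block k, sum_sigma_eq_block l] at h
  · simpa only [prod_opCoeff] using h
  · intro q p hq; rw [hU _ _ _ _ hq, smul_zero]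
  · intro q p hq; rw [hU _ _ _ _ hq.symm, smul_zero]

end Prod

end FiniteQuantumSet

namespace FiniteQuantumSet

variable {C : Type u} [CStarAlgebra C] {ι : Type v} [Fintype ι] [DecidableEq ι] {κ : Type w}

/-! ### Quantum automorphisms of the combined quantum graph -/

section Amplify

variable {X : FiniteQuantumSet C ι} {R : Type*} [Ring R] [StarRing R] [Algebra ℂ R]

/-- The matrix `V ⊗ 1`, i.e. the direct sum of `m` copies of `V`. -/
def amplify (m : ℕ) (V : ι → ι → R) : (Σ _ : Fin m, ι) → (Σ _ : Fin m, ι) → R :=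
  fun x y => if x.1 = y.1 then V x.2 y.2 else 0

theorem amplify_apply {m : ℕ} (V : ι → ι → R) (k l : Fin m) (i j : ι) :
    amplify m V ⟨k, i⟩ ⟨l, j⟩ = if k = l then V i j else 0 := rfl

theorem IsQutMatrix.amplify {V : ι → ι → R} {A : κ → C →ₗ[ℂ] C} (h : X.IsQutMatrix A V) {m : ℕ}
    {T : (Fin m → C) →ₗ[ℂ] (Fin m → C)} (hT : ∀ k l, X.Intertwines V (block T k l)) :
    (X.prod m).IsQutMatrix (fun _ : Unit => T) (amplify m V) where
  unitary_left := by
    rintro ⟨k, i⟩ ⟨l, j⟩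
    rw [sum_sigma_eq_block k]
    · simp only [amplify_apply, if_true, mul_ite, mul_zero]
      by_cases hk : k = l
      · subst hk; simp [h.unitary_left]
      · simp [hk]
    · intro q p hq; simp [amplify_apply, hq]
  unitary_right := by
    rintro ⟨k, i⟩ ⟨l, j⟩
    rw [sum_sigma_eq_block k]
    · simp only [amplify_apply, if_true]
      by_cases hk : k = l
      · subst hk; simp [h.unitary_right]
      · simp [hk, Ne.symm hk]
    · intro q p hq; simp [amplify_apply, hq.symm]
  mul := by
    rintro ⟨q, p⟩ ⟨a, j⟩ ⟨b, l⟩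
    rw [sum_sigma_eq_block q]
    · rw [sum_sigma_eq_block q]
      · by_cases hab : a = b
        · subst hab
          by_cases hq : q = a
          · subst hq
            simpa [prod_mulCoeff, amplify_apply, Fintype.sum_sigma] using h.mul p j l
          · simp [prod_mulCoeff, amplify_apply, hq]
        · rw [Finset.sum_eq_zero]
          · simp [prod_mulCoeff, hab]
          · intro i _
            refine Finset.sum_eq_zero fun ⟨d, k⟩ _ => ?_
            rw [prod_mulCoeff, amplify_apply, amplify_apply]
            by_cases hq : q = a
            · by_cases hd : d = b
              · rw [if_neg fun h => hab (hq.symm.trans (h.1.trans hd)), zero_smul]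
              · rw [if_neg hd, mul_zero, smul_zero]
            · rw [if_neg hq, zero_mul, smul_zero]
      · intro c i hc
        simp [amplify_apply, hc.symm]
    · intro c i hc
      refine Finset.sum_eq_zero fun ⟨d, k⟩ _ => ?_
      simp [prod_mulCoeff, hc.symm]
  unit := by
    rintro ⟨k, i⟩
    rw [sum_sigma_eq_block k]
    · simpa [prod_unitCoeff, amplify_apply] using h.unit i
    · intro q p hq; simp [amplify_apply, hq.symm]
  comm := by
    rintro - ⟨k, i⟩ ⟨l, j⟩
    rw [sum_sigma_eq_block k, sum_sigma_eq_block l]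
    · simpa [prod_opCoeff, amplify_apply] using hT k l i j
    · intro q p hq; simp [amplify_apply, hq]
    · intro q p hq; simp [amplify_apply, hq.symm]

/-- A block of a block diagonal matrix satisfies the relations of the quantum automorphism group
of `𝕏`, and those of the operators that it commutes with. -/
theorem IsQutMatrix.of_block {m : ℕ} {T : (Fin m → C) →ₗ[ℂ] (Fin m → C)}
    {U : (Σ _ : Fin m, ι) → (Σ _ : Fin m, ι) → R}
    (h : (X.prod m).IsQutMatrix (fun _ : Unit => T) U)
    (hU : ∀ k l i j, k ≠ l → U ⟨k, i⟩ ⟨l, j⟩ = 0) (k : Fin m) {A : κ → C →ₗ[ℂ] C}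
    (hA : ∀ a, X.Intertwines (fun i j => U ⟨k, i⟩ ⟨k, j⟩) (A a)) :
    X.IsQutMatrix A fun i j => U ⟨k, i⟩ ⟨k, j⟩ where
  unitary_left i j := by
    have := h.unitary_left ⟨k, i⟩ ⟨k, j⟩
    rw [sum_sigma_eq_block k] at this
    · simpa using this
    · intro q p hq; simp [hU _ _ _ _ hq]
  unitary_right i j := by
    have := h.unitary_right ⟨k, i⟩ ⟨k, j⟩
    rw [sum_sigma_eq_block k] at this
    · simpa using this
    · intro q p hq; simp [hU _ _ _ _ hq.symm]
  mul p j l := by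
    have := h.mul ⟨k, p⟩ ⟨k, j⟩ ⟨k, l⟩
    rw [sum_sigma_eq_block k, sum_sigma_eq_block k] at this
    · convert this using 1
      · refine Finset.sum_congr rfl fun i _ => ?_
        rw [sum_sigma_eq_block k]
        · simp [prod_mulCoeff]
        · intro a b ha; simp [hU _ _ _ _ ha]
      · simp [prod_mulCoeff]
    · intro a b ha; simp [hU _ _ _ _ ha.symm]
    · intro a b ha; simp [hU _ _ _ _ ha]
  unit i := by
    have := h.unit ⟨k, i⟩
    rw [sum_sigma_eq_block k] at this
    · simpa [prod_unitCoeff] using this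
    · intro q p hq; simp [hU _ _ _ _ hq.symm]
  comm := hA

end Amplify

open QutAlg in
/-- If `V ⊗ 1` is a quantum automorphism of `(𝕏 ⊗ ℂᵐ, T)`, and if the fundamental representation
of `Qut(𝕏 ⊗ ℂᵐ, T)` is of the form `V ⊗ 1`, then `Qut(𝕏 ⊗ ℂᵐ, T) = ⋂ₖ Qut(𝕏, A_k)`. -/
theorem qutEqInter_of_amplify (X : FiniteQuantumSet C ι) (A : κ → C →ₗ[ℂ] C) (m : ℕ)
    (T : (Fin m → C) →ₗ[ℂ] (Fin m → C))
    (h₁ : (X.prod m).IsQutMatrix (fun _ : Unit => T) (amplify m (u X A)))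
    {V : ι → ι → (X.prod m).QutAlg (fun _ : Unit => T)} (hV : X.IsQutMatrix A V)
    (h₂ : u (X.prod m) (fun _ : Unit => T) = amplify m V) (k₀ : Fin m) : X.QutEqInter A m T := by
  have hφ : ∀ k l i j, lift h₁ (u (X.prod m) (fun _ : Unit => T) ⟨k, i⟩ ⟨l, j⟩) =
      if k = l then u X A i j else 0 := fun k l i j => lift_u h₁ _ _
  have hψφ : (lift hV).comp (lift h₁) = StarAlgHom.id ℂ _ := by
    have hu : ∀ x y, lift hV (lift h₁ (u (X.prod m) (fun _ : Unit => T) x y)) =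
        u (X.prod m) (fun _ : Unit => T) x y := by
      rintro ⟨k, i⟩ ⟨l, j⟩
      rw [hφ, apply_ite (lift hV), lift_u, map_zero, h₂, amplify_apply]
    have := algHom_ext (X.prod m) (fun _ : Unit => T)
      (f := ((lift hV).comp (lift h₁)).toAlgHom) (g := (StarAlgHom.id ℂ _).toAlgHom) hu
      (fun x y => by
        change lift hV (lift h₁ (star _)) = star _
        rw [map_star, map_star, hu])
    exact StarAlgHom.ext fun x => AlgHom.congr_fun this x
  have hφψ : (lift h₁).comp (lift hV) = StarAlgHom.id ℂ _ := by
    have hu : ∀ i j, lift h₁ (lift hV (u X A i j)) = u X A i j := by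
      intro i j
      have : V i j = u (X.prod m) (fun _ : Unit => T) ⟨k₀, i⟩ ⟨k₀, j⟩ := by
        rw [h₂, amplify_apply, if_pos rfl]
      rw [lift_u, this, hφ, if_pos rfl]
    have := algHom_ext X A
      (f := ((lift h₁).comp (lift hV)).toAlgHom) (g := (StarAlgHom.id ℂ _).toAlgHom) hu
      (fun x y => by
        change lift h₁ (lift hV (star _)) = star _
        rw [map_star, map_star, hu])
    exact StarAlgHom.ext fun x => AlgHom.congr_fun this x
  refine ⟨StarAlgEquiv.ofStarAlgHom (lift h₁) (lift hV) hψφ hφψ, ?_, ?_, hφ⟩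
  · have hu : ∀ x y, comulHom X A (lift h₁ (u (X.prod m) (fun _ : Unit => T) x y)) =
        Algebra.TensorProduct.map (lift h₁).toAlgHom (lift h₁).toAlgHom
          (comulHom (X.prod m) (fun _ : Unit => T) (u (X.prod m) (fun _ : Unit => T) x y)) := by
      rintro ⟨k, i⟩ ⟨l, j⟩
      rw [comulHom_u, map_sum, hφ]
      simp only [Algebra.TensorProduct.map_tmul]
      change _ = ∑ x, lift h₁ _ ⊗ₜ[ℂ] lift h₁ _
      rw [sum_sigma_eq_block k]
      · simp only [hφ, if_true]
        by_cases hk : k = l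
        · simp [hk, comulHom_u]
        · simp [hk]
      · intro q p hq
        rw [hφ, if_neg hq.symm, TensorProduct.zero_tmul]
    have hs : ∀ x y, comulHom X A (lift h₁ (star (u (X.prod m) (fun _ : Unit => T) x y))) =
        Algebra.TensorProduct.map (lift h₁).toAlgHom (lift h₁).toAlgHom
          (comulHom (X.prod m) (fun _ : Unit => T)
            (star (u (X.prod m) (fun _ : Unit => T) x y))) := by
      rintro ⟨k, i⟩ ⟨l, j⟩
      rw [comulHom_star_u, map_sum, map_star, hφ]
      simp only [Algebra.TensorProduct.map_tmul]
      change _ = ∑ x, lift h₁ (star _) ⊗ₜ[ℂ] lift h₁ (star _)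
      rw [sum_sigma_eq_block k]
      · simp only [map_star, hφ, if_true]
        by_cases hk : k = l
        · simp only [hk, if_true, ← map_star, comulHom_star_u]
        · simp [hk]
      · intro q p hq
        rw [map_star, hφ, if_neg hq.symm, star_zero, TensorProduct.zero_tmul]
    have := algHom_ext (X.prod m) (fun _ : Unit => T)
      (f := (comulHom X A).toAlgHom.comp (lift h₁).toAlgHom)
      (g := (Algebra.TensorProduct.map (lift h₁).toAlgHom (lift h₁).toAlgHom).comp
        (comulHom (X.prod m) (fun _ : Unit => T)).toAlgHom) hu hs
    exact fun x => AlgHom.congr_fun this x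
  · have hu : ∀ x y, counitHom X A (lift h₁ (u (X.prod m) (fun _ : Unit => T) x y)) =
        counitHom (X.prod m) (fun _ : Unit => T) (u (X.prod m) (fun _ : Unit => T) x y) := by
      rintro ⟨k, i⟩ ⟨l, j⟩
      rw [hφ, counitHom_u, apply_ite (counitHom X A), counitHom_u, map_zero]
      by_cases hk : k = l
      · subst hk; simp
      · simp [hk]
    have := algHom_ext (X.prod m) (fun _ : Unit => T)
      (f := (counitHom X A).toAlgHom.comp (lift h₁).toAlgHom)
      (g := (counitHom (X.prod m) (fun _ : Unit => T)).toAlgHom) hu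
      (fun x y => by
        change counitHom X A (lift h₁ (star _)) = counitHom _ _ (star _)
        rw [map_star, map_star, map_star, hu])
    exact fun x => AlgHom.congr_fun this x

/-- The operator `B + ∑ᵢ dᵢ (E_{2i-1,2i} + E_{2i,2i-1})`. -/
def combineMatrix {n : ℕ} (d : Fin n → ℂ) (B : Matrix (Fin (2 * n + 1)) (Fin (2 * n + 1)) ℂ) :
    Matrix (Fin (2 * n + 1)) (Fin (2 * n + 1)) ℂ := fun k l =>
  B k l + ∑ i, ((if oddVertex i = k ∧ evenVertex i = l then d i else 0) +
    (if evenVertex i = k ∧ oddVertex i = l then d i else 0))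

variable {X : FiniteQuantumSet C ι} {n : ℕ} {A : Fin n → C →ₗ[ℂ] C} {d : Fin n → ℂ}
  {B : Matrix (Fin (2 * n + 1)) (Fin (2 * n + 1)) ℂ}

theorem block_combine_one (hd : ∀ i, X.IsRegular (A i) (d i)) (k l : Fin (2 * n + 1)) :
    block (X.combine A B) k l 1 = combineMatrix d B k l • (1 : C) := by
  rw [block_combine, combineMatrix, add_smul, Finset.sum_smul, LinearMap.add_apply,
    LinearMap.sum_apply]
  congr 1
  refine Finset.sum_congr rfl fun i _ => ?_
  rw [add_smul, LinearMap.add_apply]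
  congr 1
  · split_ifs <;> simp [(hd i).1]
  · split_ifs <;> simp [(hd i).2]

/-- Vertices that are joined by an edge of `B` and are not paired. -/
def PureEdge (B : Matrix (Fin (2 * n + 1)) (Fin (2 * n + 1)) ℂ) (k l : Fin (2 * n + 1)) : Prop :=
  B k l = 1 ∧ ¬ Paired k l

open QutAlg in
/-- The main criterion: `Qut(𝕏 ⊗ ℂ^{2n+1}, A'_B) = ⋂ᵢ Qut(𝕏, Aᵢ)` if no proper unital subalgebra
of `ℂ^{2n+1}` is invariant under the action of `A'_B` on it and the unpaired edges of `B` connect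
all vertices. -/
theorem qutEqInter_combine (hd : ∀ i, X.IsRegular (A i) (d i))
    (htop : ∀ S : Subalgebra ℂ (Fin (2 * n + 1) → ℂ),
      (∀ v ∈ S, (combineMatrix d B).mulVec v ∈ S) → S = ⊤)
    (hconn : ∀ k, Relation.EqvGen (PureEdge B) 0 k) :
    X.QutEqInter A (2 * n + 1) (X.combine A B) := by
  set T := X.combine A B with hT
  have hU := isQutMatrix_u (X.prod (2 * n + 1)) (fun _ : Unit => T)
  set U := u (X.prod (2 * n + 1)) (fun _ : Unit => T)
  have hdiag : ∀ k l i j, k ≠ l → U ⟨k, i⟩ ⟨l, j⟩ = 0 := fun k l i j hkl =>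
    eq_zero_of_fixedSubalgebra_eq_top hU (htop _ fun v hv =>
      mulVec_mem_fixedSubalgebra hU () (block_combine_one hd) hv) hkl i j
  have hblock := fun k l => (hU.intertwines ()).block hdiag k l
  have hpure : ∀ k l, PureEdge B k l → ∀ i j, U ⟨k, i⟩ ⟨k, j⟩ = U ⟨l, i⟩ ⟨l, j⟩ := by
    intro k l h i j
    have := hblock k l i j
    have hb : block T k l = LinearMap.id := by
      rw [hT, block_combine_of_not_paired X A B h.2, h.1, one_smul]
    rw [hb] at this
    simpa [opCoeff_id] using this
  have hall : ∀ k l, Relation.EqvGen (PureEdge B) k l →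
      ∀ i j, U ⟨k, i⟩ ⟨k, j⟩ = U ⟨l, i⟩ ⟨l, j⟩ := by
    intro k l h
    induction h with
    | rel k l h => exact hpure k l h
    | refl k => exact fun _ _ => rfl
    | symm k l _ ih => exact fun i j => (ih i j).symm
    | trans k l q _ _ ih₁ ih₂ => exact fun i j => (ih₁ i j).trans (ih₂ i j)
  have hV : X.IsQutMatrix A fun i j => U ⟨0, i⟩ ⟨0, j⟩ := by
    refine hU.of_block hdiag 0 fun a => ?_
    have h : X.Intertwines (fun i j => U ⟨0, i⟩ ⟨0, j⟩)
        (block T (oddVertex a) (evenVertex a)) := fun i j => by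
      have := hblock (oddVertex a) (evenVertex a) i j
      simpa only [← hall 0 (oddVertex a) (hconn _), ← hall 0 (evenVertex a) (hconn _)] using this
    have hb := block_combine_odd_even X A B a
    rw [← hT] at hb
    rw [hb] at h
    exact h.of_add (Intertwines.id.smul _)
  refine qutEqInter_of_amplify X A _ T ((isQutMatrix_u X A).amplify fun k l => ?_) hV ?_ 0
  · have h := isQutMatrix_u X A
    by_cases hp : Paired k l
    · obtain ⟨i, ⟨rfl, rfl⟩ | ⟨rfl, rfl⟩⟩ := hp
      · rw [hT, block_combine_odd_even]
        exact (Intertwines.id.smul _).add (h.intertwines i)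
      · rw [hT, block_combine_even_odd]
        exact (Intertwines.id.smul _).add
          ((h.intertwines i).adjoint h.unitary_left h.unitary_right)
    · rw [hT, block_combine_of_not_paired X A B hp]
      exact Intertwines.id.smul _
  · funext ⟨k, i⟩ ⟨l, j⟩
    rw [amplify_apply]
    split_ifs with hkl
    · subst hkl
      exact (hall 0 k (hconn k) i j).symm
    · exact hdiag k l i j hkl

end FiniteQuantumSet

/-! ### Subalgebras of `ℂ^σ` -/

theorem Subalgebra.single_mem_of_separates {σ : Type*} [Fintype σ] [DecidableEq σ]
    (S : Subalgebra ℂ (σ → ℂ)) (k : σ) (h : ∀ l, l ≠ k → ∃ v ∈ S, v k ≠ v l) :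
    Pi.single k 1 ∈ S := by
  choose! f hfS hf using h
  have hprod : (Pi.single k 1 : σ → ℂ) = ∏ l ∈ Finset.univ.erase k,
      ((f l k - f l l)⁻¹ • (f l - algebraMap ℂ (σ → ℂ) (f l l))) := by
    ext q
    rw [Finset.prod_apply]
    by_cases hq : q = k
    · subst hq
      rw [Pi.single_eq_same, Finset.prod_eq_one]
      intro l hl
      simp [inv_mul_cancel₀ (sub_ne_zero.2 (hf l (Finset.ne_of_mem_erase hl)))]
    · rw [Pi.single_eq_of_ne hq, Finset.prod_eq_zero (i := q)]
      · simp [hq]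
      · simp
  rw [hprod]
  exact S.prod_mem fun l hl => S.smul_mem (S.sub_mem (hfS l (Finset.ne_of_mem_erase hl))
    (S.algebraMap_mem _)) _

theorem Subalgebra.eq_top_of_separates {σ : Type*} [Fintype σ] [DecidableEq σ]
    (S : Subalgebra ℂ (σ → ℂ)) (h : ∀ k l, l ≠ k → ∃ v ∈ S, v k ≠ v l) : S = ⊤ := by
  refine eq_top_iff.2 fun v _ => ?_
  rw [pi_eq_sum_univ' v]
  refine S.sum_mem fun k _ => S.smul_mem ?_ _
  convert S.single_mem_of_separates k (h k) using 1

/-! ### Degrees -/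

theorem vertex_cases {n : ℕ} (k : Fin (2 * n + 1)) :
    k = 0 ∨ ∃ i : Fin n, k = oddVertex i ∨ k = evenVertex i := by
  rcases Nat.eq_zero_or_pos k.val with h | h
  · exact Or.inl (Fin.ext h)
  · refine Or.inr ⟨⟨(k.val - 1) / 2, by omega⟩, ?_⟩
    simp only [oddVertex, evenVertex, Fin.ext_iff]
    omega

theorem Paired.val {n : ℕ} {k l : Fin (2 * n + 1)} (h : Paired k l) :
    (k.val % 2 = 1 ∧ l.val = k.val + 1) ∨ (l.val % 2 = 1 ∧ k.val = l.val + 1) := by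
  obtain ⟨i, ⟨rfl, rfl⟩ | ⟨rfl, rfl⟩⟩ := h
  · exact Or.inl ⟨show (2 * i.val + 1) % 2 = 1 by omega, rfl⟩
  · exact Or.inr ⟨show (2 * i.val + 1) % 2 = 1 by omega, rfl⟩

/-- The contribution of the `Aᵢ` to the degree of the vertex `k`. -/
def weight {n : ℕ} (d : Fin n → ℝ) (k : Fin (2 * n + 1)) : ℝ :=
  ∑ i, ((if oddVertex i = k then d i else 0) + (if evenVertex i = k then d i else 0))

section Weight

variable {n : ℕ} (d : Fin n → ℝ)

theorem weight_zero : weight d 0 = 0 := by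
  simp [weight, oddVertex, evenVertex, Fin.ext_iff]

theorem weight_oddVertex (i : Fin n) : weight d (oddVertex i) = d i := by
  simp [weight, oddVertex_injective.eq_iff, (oddVertex_ne_evenVertex _ _).symm]

theorem weight_evenVertex (i : Fin n) : weight d (evenVertex i) = d i := by
  simp [weight, evenVertex_injective.eq_iff, oddVertex_ne_evenVertex]

variable {d}

theorem weight_nonneg (hd : ∀ i, 0 ≤ d i) (k : Fin (2 * n + 1)) : 0 ≤ weight d k := by
  obtain rfl | ⟨i, rfl | rfl⟩ := vertex_cases k
  · rw [weight_zero]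
  · rw [weight_oddVertex]; exact hd i
  · rw [weight_evenVertex]; exact hd i

theorem weight_mono (hd : ∀ i, 0 ≤ d i) (hm : Monotone d) : Monotone (weight d) := by
  intro k l hkl
  obtain rfl | ⟨i, hi⟩ := vertex_cases k
  · rw [weight_zero]; exact weight_nonneg hd l
  obtain rfl | ⟨j, hj⟩ := vertex_cases l
  · rcases hi with rfl | rfl <;> simp [oddVertex, evenVertex] at hkl
  have hij : i ≤ j := by
    rcases hi with rfl | rfl <;> rcases hj with rfl | rfl <;>
      simp only [oddVertex, evenVertex, Fin.le_def] at hkl ⊢ <;> omega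
  have hw : ∀ k i, k = oddVertex i ∨ k = evenVertex i → weight d k = d i := by
    rintro k i (rfl | rfl)
    · exact weight_oddVertex d i
    · exact weight_evenVertex d i
  rw [hw k i hi, hw l j hj]
  exact hm hij

end Weight

namespace FiniteQuantumSet

variable {n : ℕ} {d : Fin n → ℝ} {B : Matrix (Fin (2 * n + 1)) (Fin (2 * n + 1)) ℂ}

theorem combineMatrix_mulVec_one (d : Fin n → ℝ) (B : Matrix (Fin (2 * n + 1)) (Fin (2 * n + 1)) ℂ)
    (k : Fin (2 * n + 1)) :
    (combineMatrix (fun i => (d i : ℂ)) B).mulVec 1 k = ∑ l, B k l + (weight d k : ℂ) := by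
  simp only [Matrix.mulVec, dotProduct, Pi.one_apply, mul_one, combineMatrix,
    Finset.sum_add_distrib]
  rw [Finset.sum_comm, Finset.sum_comm (f := fun l i => if evenVertex i = k ∧ oddVertex i = l then
    ((d i : ℝ) : ℂ) else 0)]
  simp [weight, ite_and, Finset.sum_add_distrib, apply_ite Complex.ofReal]

theorem combineMatrix_of_not_paired (d : Fin n → ℂ) {k l : Fin (2 * n + 1)} (h : ¬ Paired k l) :
    combineMatrix d B k l = B k l := by
  rw [combineMatrix, Finset.sum_eq_zero, add_zero]
  intro i _
  rw [if_neg, if_neg, add_zero]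
  · rintro ⟨rfl, rfl⟩; exact h ⟨i, Or.inr ⟨rfl, rfl⟩⟩
  · rintro ⟨rfl, rfl⟩; exact h ⟨i, Or.inl ⟨rfl, rfl⟩⟩

/-- If the vertices have different degrees, the invariant subalgebras are trivial. -/
theorem eq_top_of_degree_injective (r : Fin (2 * n + 1) → ℝ) (hr : ∀ k, ∑ l, B k l = (r k : ℂ))
    (hinj : Function.Injective fun k => r k + weight d k)
    (S : Subalgebra ℂ (Fin (2 * n + 1) → ℂ))
    (hS : ∀ v ∈ S, (combineMatrix (fun i => (d i : ℂ)) B).mulVec v ∈ S) : S = ⊤ := by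
  refine S.eq_top_of_separates fun k l hkl => ⟨_, hS 1 S.one_mem, fun h => hkl ?_⟩
  rw [combineMatrix_mulVec_one, combineMatrix_mulVec_one, hr, hr] at h
  exact (hinj (by exact_mod_cast h)).symm

theorem eqvGen_pureEdge (hn : 2 ≤ n) (r : Fin (2 * n + 1) → Fin (2 * n + 1))
    (hr : Function.Bijective r) (hr0 : r 0 = 0)
    (hB : ∀ k l, ¬ Paired (r k) (r l) → (r k).val ≠ (r l).val →
      (2 * n < (r k).val + (r l).val ∨ (r k).val = 0 ∧ (r l).val = 2 * n) → PureEdge B k l)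
    (k : Fin (2 * n + 1)) : Relation.EqvGen (PureEdge B) 0 k := by
  obtain ⟨z, hz⟩ := hr.2 ⟨2 * n, by omega⟩
  obtain ⟨y, hy⟩ := hr.2 ⟨2 * n - 2, by omega⟩
  have hz' : (r z).val = 2 * n := congrArg Fin.val hz
  have hy' : (r y).val = 2 * n - 2 := congrArg Fin.val hy
  have hr0' : (r 0).val = 0 := congrArg Fin.val hr0
  have h0z : ∀ k, (r k).val = 0 → Relation.EqvGen (PureEdge B) k z := fun k h =>
    .rel _ _ <| hB _ _ (fun h => by have := h.val; omega) (by omega) (by omega)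
  have hzk : ∀ k, 0 < (r k).val → (r k).val ≤ 2 * n - 2 → Relation.EqvGen (PureEdge B) z k :=
    fun k h₁ h₂ => .rel _ _ <| hB _ _ (fun h => by have := h.val; omega) (by omega) (by omega)
  have hyk : ∀ k, (r k).val = 2 * n - 1 → Relation.EqvGen (PureEdge B) y k :=
    fun k h₁ => .rel _ _ <| hB _ _ (fun h => by have := h.val; omega) (by omega) (by omega)
  have hlt := (r k).isLt
  refine (h0z 0 hr0').trans _ _ _ ?_
  rcases Nat.eq_zero_or_pos (r k).val with h | h
  · exact (h0z k h).symm _ _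
  · by_cases hk : (r k).val ≤ 2 * n - 2
    · exact hzk k h hk
    · by_cases hk' : (r k).val = 2 * n - 1
      · exact (hzk y (by omega) hy'.le).trans _ _ _ (hyk k hk')
      · rw [hr.1 (Fin.ext (by omega : (r k).val = (r z).val))]
        exact .refl _

/-! ### The threshold graph -/

theorem isGraphMatrix_thresholdMatrix (n : ℕ) : IsGraphMatrix (thresholdMatrix n) where
  zero_or_one k l := by
    unfold thresholdMatrix
    split_ifs <;> simp
  symm := by
    ext k l
    simp only [Matrix.transpose_apply, thresholdMatrix]
    congr 1
    rw [ne_comm, Nat.add_comm l.val]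
    apply propext
    tauto

theorem thresholdMatrix_self (n : ℕ) (k : Fin (2 * n + 1)) : thresholdMatrix n k k = 0 := by
  simp [thresholdMatrix]

theorem sum_thresholdMatrix (n : ℕ) (k : Fin (2 * n + 1)) :
    ∑ l, thresholdMatrix n k l = ((if k.val = 0 then n else k.val : ℕ) : ℂ) := by
  let f : ℕ → ℂ := fun l => if k.val ≠ l ∧ ((0 < k.val ∧ 0 < l ∧ 2 * n < k.val + l) ∨
    (k.val = 0 ∧ n < l) ∨ (l = 0 ∧ n < k.val)) then 1 else 0
  have h : ∀ l : Fin (2 * n + 1), thresholdMatrix n k l =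
      f l := fun l => by
    simp only [thresholdMatrix, ne_eq, Fin.ext_iff, f]
  rw [Finset.sum_congr rfl fun l _ => h l, Fin.sum_univ_eq_sum_range f, Finset.sum_boole]
  congr 1
  have hk := k.isLt
  split_ifs with h0
  · rw [show Finset.filter _ _ = Finset.Ioc n (2 * n) by
      ext l; simp only [Finset.mem_filter, Finset.mem_range, Finset.mem_Ioc]; omega]
    rw [Nat.card_Ioc]; omega
  · by_cases hkn : k.val ≤ n
    · rw [show Finset.filter _ _ = Finset.Ioc (2 * n - k.val) (2 * n) by
        ext l; simp only [Finset.mem_filter, Finset.mem_range, Finset.mem_Ioc]; omega]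
      rw [Nat.card_Ioc]; omega
    · rw [show Finset.filter _ _ = insert 0 ((Finset.Ioc (2 * n - k.val) (2 * n)).erase k.val) by
        ext l
        simp only [Finset.mem_filter, Finset.mem_range, Finset.mem_Ioc, Finset.mem_insert,
          Finset.mem_erase]
        omega]
      rw [Finset.card_insert_of_notMem (by simp), Finset.card_erase_of_mem
        (by rw [Finset.mem_Ioc]; omega), Nat.card_Ioc]
      omega

/-- For the threshold graph, the degrees and the neighbours of the vertex `n + 1` separate all
vertices. -/
theorem eq_top_thresholdMatrix (hn : 1 ≤ n) (hd : ∀ i, 0 ≤ d i) (hm : Monotone d)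
    (hpos : ∀ i : Fin n, n ≤ 2 * (i.val + 1) → 0 < d i)
    (S : Subalgebra ℂ (Fin (2 * n + 1) → ℂ))
    (hS : ∀ v ∈ S, (combineMatrix (fun i => (d i : ℂ)) (thresholdMatrix n)).mulVec v ∈ S) :
    S = ⊤ := by
  have hw := weight_mono hd hm
  have hw0 := weight_nonneg hd
  set r : Fin (2 * n + 1) → ℝ := fun k =>
    ((if k.val = 0 then n else k.val : ℕ) : ℝ) + weight d k with hr
  have hdeg : ∀ k l, r k ≠ r l → ∃ v ∈ S, v k ≠ v l := fun k l hkl =>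
    ⟨_, hS 1 S.one_mem, fun h => hkl (by
      rw [combineMatrix_mulVec_one, combineMatrix_mulVec_one, sum_thresholdMatrix,
        sum_thresholdMatrix] at h
      apply Complex.ofReal_injective
      simp only [hr, Complex.ofReal_add, Complex.ofReal_natCast]
      exact h)⟩
  have hlt : ∀ k l : Fin (2 * n + 1), 0 < k.val → k < l → r k < r l := fun k l hk hkl => by
    have h₁ : (k.val : ℝ) < l.val := by exact_mod_cast hkl
    have h₂ : l.val ≠ 0 := by have := Fin.lt_def.1 hkl; omega
    simp only [hr, if_neg hk.ne', if_neg h₂]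
    exact add_lt_add_of_lt_of_le h₁ (hw hkl.le)
  have h0lt : ∀ l : Fin (2 * n + 1), n ≤ l.val → r 0 < r l := fun l hl => by
    have h₂ : l.val ≠ 0 := by omega
    simp only [hr, Fin.val_zero, if_true, weight_zero, add_zero, if_neg h₂]
    rcases hl.lt_or_eq with h | h
    · have h₁ : (n : ℝ) < l.val := by exact_mod_cast h
      linarith [hw0 l]
    · have h₁ : 0 < weight d l := by
        obtain rfl | ⟨i, rfl | rfl⟩ := vertex_cases l
        · exact absurd rfl h₂
        · rw [weight_oddVertex]
          exact hpos i (by simp only [oddVertex] at h; omega)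
        · rw [weight_evenVertex]
          exact hpos i (by simp only [evenVertex] at h; omega)
      rw [← h]
      linarith
  obtain ⟨c, hc⟩ : ∃ c : Fin (2 * n + 1), c.val = n + 1 := ⟨⟨n + 1, by omega⟩, rfl⟩
  have h0 : (0 : Fin (2 * n + 1)).val = 0 := rfl
  have hcS : Pi.single c 1 ∈ S := by
    refine S.single_mem_of_separates c fun l hl => hdeg _ _ ?_
    by_cases hl0 : l = 0
    · subst hl0
      exact (h0lt c (by omega)).ne'
    · have hl0' : 0 < l.val := Nat.pos_of_ne_zero fun h => hl0 (Fin.ext h)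
      rcases lt_or_gt_of_ne hl with h | h
      · exact (hlt l c hl0' h).ne'
      · exact (hlt c l (by omega) h).ne
  have hzero : ∀ l : Fin (2 * n + 1), l ≠ 0 → ∃ v ∈ S, v 0 ≠ v l := fun l hl => by
    have hl0 : 0 < l.val := Nat.pos_of_ne_zero fun h => hl (Fin.ext h)
    by_cases hln : n ≤ l.val
    · exact hdeg _ _ (h0lt l hln).ne
    · refine ⟨_, hS _ hcS, ?_⟩
      rw [Matrix.mulVec_single_one, Matrix.col_apply, Matrix.col_apply,
        combineMatrix_of_not_paired, combineMatrix_of_not_paired, thresholdMatrix,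
        thresholdMatrix, if_pos, if_neg]
      · exact one_ne_zero
      · simp only [ne_eq, Fin.ext_iff]; omega
      · simp only [ne_eq, Fin.ext_iff]; omega
      · intro h; have := h.val; omega
      · intro h; have := h.val; omega
  refine S.eq_top_of_separates fun k l hkl => ?_
  by_cases hk : k = 0
  · subst hk; exact hzero l hkl
  · by_cases hl : l = 0
    · subst hl
      obtain ⟨v, hv, h⟩ := hzero k hk
      exact ⟨v, hv, h.symm⟩
    · have hk0 : 0 < k.val := Nat.pos_of_ne_zero fun h => hk (Fin.ext h)
      have hl0 : 0 < l.val := Nat.pos_of_ne_zero fun h => hl (Fin.ext h)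
      rcases lt_or_gt_of_ne hkl with h | h
      · exact hdeg _ _ (hlt l k hl0 h).ne'
      · exact hdeg _ _ (hlt k l hk0 h).ne

end FiniteQuantumSet

/-! ### Relabelling the vertices -/

/-- The permutation of the vertices that is given by a permutation of the pairs. -/
def relabel {n : ℕ} (π : Equiv.Perm (Fin n)) (k : Fin (2 * n + 1)) : Fin (2 * n + 1) :=
  if h : k.val = 0 then 0
  else if k.val % 2 = 1 then oddVertex (π ⟨(k.val - 1) / 2, by omega⟩)
  else evenVertex (π ⟨(k.val - 1) / 2, by omega⟩)

section Relabel

variable {n : ℕ} (π : Equiv.Perm (Fin n))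

theorem relabel_zero : relabel π 0 = 0 := by simp [relabel]

theorem relabel_oddVertex (i : Fin n) : relabel π (oddVertex i) = oddVertex (π i) := by
  rw [relabel, dif_neg (by simp [oddVertex]), if_pos (by simp only [oddVertex]; omega)]
  congr 2
  ext
  simp [oddVertex]

theorem relabel_evenVertex (i : Fin n) : relabel π (evenVertex i) = evenVertex (π i) := by
  rw [relabel, dif_neg (by simp [evenVertex]), if_neg (by simp only [evenVertex]; omega)]
  congr 2
  ext
  simp only [evenVertex]
  omega

theorem relabel_bijective : Function.Bijective (relabel π) := by
  have hs : Function.Surjective (relabel π) := fun k => by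
    obtain rfl | ⟨i, rfl | rfl⟩ := vertex_cases k
    · exact ⟨0, relabel_zero π⟩
    · exact ⟨oddVertex (π.symm i), by rw [relabel_oddVertex, Equiv.apply_symm_apply]⟩
    · exact ⟨evenVertex (π.symm i), by rw [relabel_evenVertex, Equiv.apply_symm_apply]⟩
  exact ⟨Finite.injective_iff_surjective.2 hs, hs⟩

theorem Paired.relabel {k l : Fin (2 * n + 1)} (h : Paired k l) :
    Paired (relabel π k) (relabel π l) := by
  obtain ⟨i, ⟨rfl, rfl⟩ | ⟨rfl, rfl⟩⟩ := h
  · exact ⟨π i, Or.inl ⟨relabel_oddVertex π i, relabel_evenVertex π i⟩⟩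
  · exact ⟨π i, Or.inr ⟨relabel_evenVertex π i, relabel_oddVertex π i⟩⟩

theorem weight_relabel (d : Fin n → ℝ) (k : Fin (2 * n + 1)) :
    weight d (relabel π k) = weight (d ∘ π) k := by
  obtain rfl | ⟨i, rfl | rfl⟩ := vertex_cases k
  · rw [relabel_zero, weight_zero, weight_zero]
  · rw [relabel_oddVertex, weight_oddVertex, weight_oddVertex]; rfl
  · rw [relabel_evenVertex, weight_evenVertex, weight_evenVertex]; rfl

end Relabel

namespace FiniteQuantumSet

/-- The threshold graph with loops, with the vertices relabelled. -/
def loopThresholdMatrix {n : ℕ} (π : Equiv.Perm (Fin n)) :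
    Matrix (Fin (2 * n + 1)) (Fin (2 * n + 1)) ℂ := fun k l =>
  if 2 * n ≤ (relabel π k).val + (relabel π l).val then 1 else 0

theorem isGraphMatrix_loopThresholdMatrix {n : ℕ} (π : Equiv.Perm (Fin n)) :
    IsGraphMatrix (loopThresholdMatrix π) where
  zero_or_one k l := by
    unfold loopThresholdMatrix
    split_ifs <;> simp
  symm := by
    ext k l
    simp only [Matrix.transpose_apply, loopThresholdMatrix, Nat.add_comm]

theorem sum_loopThresholdMatrix {n : ℕ} (π : Equiv.Perm (Fin n)) (k : Fin (2 * n + 1)) :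
    ∑ l, loopThresholdMatrix π k l = (((relabel π k).val + 1 : ℝ) : ℂ) := by
  let f : ℕ → ℂ := fun l => if 2 * n ≤ (relabel π k).val + l then 1 else 0
  have h : ∀ l, loopThresholdMatrix π k l = f (relabel π l).val := fun l => rfl
  have hk := (relabel π k).isLt
  rw [Finset.sum_congr rfl fun l _ => h l,
    (relabel_bijective π).sum_comp fun l : Fin (2 * n + 1) => f l.val,
    Fin.sum_univ_eq_sum_range f, Finset.sum_boole,
    show Finset.filter _ _ = Finset.Icc (2 * n - (relabel π k).val) (2 * n) by
      ext l; simp only [Finset.mem_filter, Finset.mem_range, Finset.mem_Icc]; omega,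
    Nat.card_Icc, show 2 * n + 1 - (2 * n - (relabel π k).val) = (relabel π k).val + 1 by omega]
  push_cast
  rfl

/-- For every choice of nonnegative degrees, some graph matrix `B` satisfies the hypotheses of
`qutEqInter_combine`. -/
theorem exists_isGraphMatrix {n : ℕ} (d : Fin n → ℝ) (hd : ∀ i, 0 ≤ d i) :
    ∃ B : Matrix (Fin (2 * n + 1)) (Fin (2 * n + 1)) ℂ, IsGraphMatrix B ∧
      (∀ S : Subalgebra ℂ (Fin (2 * n + 1) → ℂ),
        (∀ v ∈ S, (combineMatrix (fun i => (d i : ℂ)) B).mulVec v ∈ S) → S = ⊤) ∧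
      ∀ k, Relation.EqvGen (PureEdge B) 0 k := by
  rcases lt_or_ge n 2 with hn | hn
  · interval_cases n
    · refine ⟨0, ⟨fun _ _ => Or.inl rfl, rfl⟩, fun S _ => S.eq_top_of_separates fun k l hkl => ?_,
        fun k => ?_⟩
      · exact absurd (Subsingleton.elim (α := Fin 1) l k) hkl
      · rw [Subsingleton.elim (α := Fin 1) k 0]
        exact .refl _
    · set b : ℝ := if d 0 = 0 then 0 else 1 with hb
      have hb01 : b = 0 ∨ b = 1 := by rw [hb]; split_ifs <;> simp
      let B : Matrix (Fin 3) (Fin 3) ℂ := !![1 - (b : ℂ), 1, 1; 1, 1, b; 1, b, 0]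
      refine ⟨B, ⟨fun k l => ?_, ?_⟩, ?_, fun k => ?_⟩
      · change Fin 3 at k l
        fin_cases k <;> fin_cases l <;> rcases hb01 with h | h <;> simp [B, h]
      · ext k l
        change Fin 3 at k l
        fin_cases k <;> fin_cases l <;> simp [B]
      · refine eq_top_of_degree_injective (![3 - b, 2 + b, 1 + b] : Fin 3 → ℝ) (fun k => ?_) ?_
        · change ∑ l : Fin 3, B k l = _
          change Fin 3 at k
          fin_cases k <;> simp [B, Fin.sum_univ_three] <;> ring
        · have h1 : weight d (1 : Fin 3) = d 0 := weight_oddVertex d 0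
          have h2 : weight d (2 : Fin 3) = d 0 := weight_evenVertex d 0
          have h0 : weight d (0 : Fin 3) = 0 := weight_zero d
          have hd0 := hd 0
          intro k l hkl
          change Fin 3 at k l
          by_cases hz : d 0 = 0
          · rw [if_pos hz] at hb
            fin_cases k <;> fin_cases l <;> simp [h0, h1, h2, hb, hz] at hkl ⊢
          · rw [if_neg hz] at hb
            have hpos := hd0.lt_of_ne (Ne.symm hz)
            fin_cases k <;> fin_cases l <;> simp [h0, h1, h2, hb] at hkl ⊢ <;> linarith
      · have hp : ∀ l : Fin 3, l ≠ 0 → PureEdge (n := 1) B 0 l := fun l hl => by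
          refine ⟨?_, fun h => ?_⟩
          · fin_cases l <;> simp [B] at hl ⊢
          · rcases h.val with h | h
            · exact absurd h.1 (by decide)
            · exact Nat.succ_ne_zero _ h.2.symm
        by_cases hk : k = 0
        · rw [hk]; exact .refl _
        · exact .rel _ _ (hp k hk)
  · set π : Equiv.Perm (Fin n) := (Tuple.sort d)⁻¹
    have hw : Monotone (weight (d ∘ π.symm)) :=
      weight_mono (fun i => hd _) (Tuple.monotone_sort d)
    have hwk : ∀ k, weight d k = weight (d ∘ π.symm) (relabel π k) := fun k => by
      rw [weight_relabel]
      congr 1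
      ext i
      simp
    refine ⟨loopThresholdMatrix π, isGraphMatrix_loopThresholdMatrix π,
      eq_top_of_degree_injective _ (sum_loopThresholdMatrix π) ?_,
      eqvGen_pureEdge hn _ (relabel_bijective π) (relabel_zero π) fun k l hp hne h =>
        ⟨if_pos (by omega), fun h => hp (h.relabel π)⟩⟩
    have hmono : StrictMono fun k : Fin (2 * n + 1) =>
        (k.val + 1 : ℝ) + weight (d ∘ π.symm) k := fun k l hkl => by
      have : (k.val : ℝ) < l.val := by exact_mod_cast hkl
      have := hw hkl.le
      simp only
      linarith
    simp only [hwk]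
    exact hmono.injective.comp (relabel_bijective π).1

/-- In degenerate cases, the degrees are not determined by the quantum graphs; they can always be
chosen to be nonnegative real numbers. -/
theorem exists_nonneg_degrees {C : Type*} [CStarAlgebra C] {ι : Type*} [Fintype ι] [DecidableEq ι]
    {X : FiniteQuantumSet C ι} {σ : Type*} {A : σ → C →ₗ[ℂ] C}
    (hgraph : ∀ i, X.IsQuantumGraph (A i)) (hreg : ∀ i, ∃ d : ℂ, X.IsRegular (A i) d) :
    ∃ d : σ → ℝ, (∀ i, 0 ≤ d i) ∧ ∀ i, X.IsRegular (A i) (d i) := by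
  rcases subsingleton_or_nontrivial C with hC | hC
  · exact ⟨0, fun _ => le_rfl, fun i => ⟨Subsingleton.elim _ _, Subsingleton.elim _ _⟩⟩
  · choose d hd using hreg
    have hnn := fun i => (hd i).nonneg (hgraph i)
    refine ⟨fun i => (d i).re, fun i => (Complex.nonneg_iff.1 (hnn i)).1, fun i => ?_⟩
    rw [← Complex.eq_re_of_ofReal_le (r := 0) (by simpa using hnn i)]
    exact hd i

end FiniteQuantumSet

end

theorem theorem5p4 {C : Type*} [CStarAlgebra C] {ι : Type*} [Fintype ι] [DecidableEq ι]
    (X : FiniteQuantumSet C ι) (n : ℕ) (A : Fin n → C →ₗ[ℂ] C)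
    (hgraph : ∀ i, X.IsQuantumGraph (A i))
    (hloops : ∀ i, X.NoLoops (A i))
    (hreg : ∀ i, ∃ d : ℂ, X.IsRegular (A i) d) :
    (∃ B : Matrix (Fin (2 * n + 1)) (Fin (2 * n + 1)) ℂ, IsGraphMatrix B ∧
      (X.prod (2 * n + 1)).IsQuantumGraph (X.combine A B) ∧
      (X.prod (2 * n + 1)).IsUndirected (X.combine A B) ∧
      X.QutEqInter A (2 * n + 1) (X.combine A B)) ∧
    (∀ d : Fin n → ℝ, 2 ≤ n → Monotone d → (∀ i, X.IsRegular (A i) (d i)) →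
      (∀ i : Fin n, n ≤ 2 * (i.val + 1) → A i ≠ 0) →
      (X.prod (2 * n + 1)).IsQuantumGraph (X.combine A (thresholdMatrix n)) ∧
      (X.prod (2 * n + 1)).IsUndirected (X.combine A (thresholdMatrix n)) ∧
      (X.prod (2 * n + 1)).NoLoops (X.combine A (thresholdMatrix n)) ∧
      X.QutEqInter A (2 * n + 1) (X.combine A (thresholdMatrix n))) := by
  constructor
  · obtain ⟨d, hd, hA⟩ := FiniteQuantumSet.exists_nonneg_degrees hgraph hreg
    obtain ⟨B, hB, htop, hconn⟩ := FiniteQuantumSet.exists_isGraphMatrix d hd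
    exact ⟨B, hB, FiniteQuantumSet.isQuantumGraph_combine hgraph hloops hB,
      FiniteQuantumSet.isUndirected_combine hB,
      FiniteQuantumSet.qutEqInter_combine hA htop hconn⟩
  · intro d hn hm hd hne
    have hB := FiniteQuantumSet.isGraphMatrix_thresholdMatrix n
    refine ⟨FiniteQuantumSet.isQuantumGraph_combine hgraph hloops hB,
      FiniteQuantumSet.isUndirected_combine hB,
      FiniteQuantumSet.noLoops_combine (FiniteQuantumSet.thresholdMatrix_self n), ?_⟩
    have hC : Nontrivial C := by
      by_contra h
      rw [not_nontrivial_iff_subsingleton] at h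
      exact hne ⟨n - 1, by omega⟩ (by simp only; omega)
        (LinearMap.ext fun x => Subsingleton.elim _ _)
    have hnn : ∀ i, 0 ≤ d i := fun i => by exact_mod_cast (hd i).nonneg (hgraph i)
    have hpos : ∀ i : Fin n, n ≤ 2 * (i.val + 1) → 0 < d i := fun i hi =>
      (hnn i).lt_of_ne fun h => hne i hi ((by simpa [← h] using hd i :
        X.IsRegular (A i) 0).eq_zero (hgraph i))
    refine FiniteQuantumSet.qutEqInter_combine hd
      (FiniteQuantumSet.eq_top_thresholdMatrix (by omega) hnn hm hpos)
      (FiniteQuantumSet.eqvGen_pureEdge hn _ Function.bijective_id rfl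
        fun k l hp hne' h => ⟨if_pos ?_, hp⟩)
    simp only [id_eq, ne_eq, Fin.ext_iff] at *
    omega
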